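/- **Setting.** Let $d,k,T,c_{\max}$ be non-negative integers and $\epsilon,\delta>0$. A stream is $x=(x^1,\dots,x^T)$ with $x^t\in\{0,1\}^d$; two streams are neighboring if they differ in at most one time step. A randomized algorithm $A$ on streams is $(\epsilon,\delta)$-DP if $\Pr[A(x)\in S]\le e^{\epsilon}\Pr[A(y)\in S]+\delta$ for all neighboring $x,y$ and all measurable sets $S$ of outputs. A *histogram mechanism* $H$ is a randomized online mechanism that receives vectors in $\mathbb N^d$ one by one and answers each with a vector in $\mathbb R^d$ that depends on its random coins and the inputs so far. It is *adaptively $(\epsilon',\delta')$-DP for stream length $N$* if the following holds for every randomized adversary that plays $N$ rounds against $H$. In each round the adversary chooses, based on its own coins and the answers of $H$ so far, either one input $v\in\mathbb N^d$ (regular round) or a pair $(v^{(L)},v^{(R)})\in(\mathbb N^d)^2$ with $\|v^{(L)}-v^{(R)}\|_\infty\le 1$ (challenge round), where exactly one round is a challenge round; $H$ receives $v$, respectively $v^{(\mathrm{side})}$, and answers. With $V^{(\mathrm{side})}$ the adversary's view (its coins, its outputs and the answers of $H$), for all measurable sets $S$ of views $$\Pr[V^{(L)}\in S]\le e^{\epsilon'}\Pr[V^{(R)}\in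 S]+\delta'\quad\text{and}\quad \Pr[V^{(R)}\in S]\le e^{\epsilon'}\Pr[V^{(L)}\in S]+\delta'.$$ Let $g_1,\dots,g_k:\mathbb R^d\to\mathbb R$ be measurable monotone histogram queries with sensitivity 1, i.e. $g_i(v)\le g_i(v+u)$ for $v\in\mathbb N^d$, $u\in\{0,1\}^d$; $|g_i(v)-g_i(w)|\le 1$ for $v,w\in\mathbb R^d$ with $\|v-w\|_\infty\le1$; and $g_i(0)=0$. **Mechanism.** The $k$-query partitioning mechanism is run on $x$ with a histogram mechanism $H$ for stream length $k c_{\max}$ and with parameters $s_0\in\mathbb R^d$, $\kappa\in\mathbb R^k$, $K,C\in\mathbb R$. Initially $j=1$, $c=0\in\mathbb N^d$, $s=s_0$, $K_{(i)}=\kappa_i$ for all $i\in[k]$, $\tau\sim\mathrm{Lap}(6/\epsilon)$, $\mathrm{out}=(g_1(0),\dots,g_k(0))$. At each time $t=1,\dots,T$: 1. $c\leftarrow c+x^t$, $s\leftarrow s+x^t$, and draw $\mu\sim\mathrm{Lap}(12/\epsilon)$. 2. If $g_i(s)+\mu>K_{(i)}+\tau$ for some $i\in[k]$, and $j\le k c_{\max}$: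 set $j\leftarrow j+1$; insert $c$ into $H$ and reset $c\leftarrow 0$; for each $i\in[k]$ draw $\nu_i\sim N\big(0,\,18k\ln(4e^{2\epsilon/3}/\delta)/\epsilon^2\big)$ and, if $g_i(s)+\nu_i>K_{(i)}-C$, set $K_{(i)}\leftarrow K_{(i)}+K$; draw a new $\tau\sim\mathrm{Lap}(6/\epsilon)$; let $s$ be the answer of $H$; and set $\mathrm{out}\leftarrow(g_1(s),\dots,g_k(s))$. 3. Output $\mathrm{out}$. Here all noises are independent of each other and of the coins of $H$, and $N(0,\sigma^2)$ is read as the point mass at $0$ if the displayed expression for $\sigma^2$ is not positive. The *standard setting* for an error bound $\mathrm{err}(\cdot)$ and a failure probability $\beta$ is $s_0=0$, $C=\alpha_{SV}+\alpha_U$, $K=3(C+\mathrm{err}(k c_{\max}))$ and $\kappa_i=K$ for all $i$, where $\alpha_{SV}=12\epsilon^{-1}(\ln(6kc_{\max}/\beta)+\ln(6T/\beta))$ and $\alpha_U=6\epsilon^{-1}\sqrt{k\ln(12e^{2\epsilon/3}kc_{\max}/(\beta\delta))}$. **Statement.** If $H$ is adaptively $\big(\epsilon/3,\ \delta/(2e^{2\epsilon/3})\big)$-DP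 for stream length $k c_{\max}$, then the mechanism with the standard setting (for any $\beta$ and $\mathrm{err}$; if an expression in $\alpha_{SV},\alpha_U$ is undefined, an arbitrary real value may be used) is $(\epsilon,\delta)$-DP. Moreover this holds independently of the initial setting: for all $s_0\in\mathbb R^d$, $\kappa\in\mathbb R^k$ and $K,C\in\mathbb R$ the mechanism is $(\epsilon,\delta)$-DP. -/

import Mathlib

open MeasureTheory ProbabilityTheory

noncomputable section

namespace KQuery

/-! ### Streams and differential privacy -/

/-- A stream `x^1, …, x^T` of elements of `{0,1}^d`. -/
abbrev Stream (d T : ℕ) : Type := Fin T → Fin d → Bool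

/-- An element of `{0,1}^d` as a vector of natural numbers. -/
def rowNat {d : ℕ} (u : Fin d → Bool) : Fin d → ℕ := fun i => (u i).toNat

/-- A vector of natural numbers as a vector of real numbers. -/
def toReal {d : ℕ} (v : Fin d → ℕ) : Fin d → ℝ := fun i => (v i : ℝ)

/-- Two streams are neighboring if they differ in at most one time step. -/
def Neighboring {d T : ℕ} (x y : Stream d T) : Prop := {t | x t ≠ y t}.Subsingleton

/-- `(ε, δ)`-differential privacy (event level) of the randomized algorithm `A`, which uses random
coins drawn from `P` and maps a stream and the coins to an output. -/
def IsDP {d T : ℕ} {Ω O : Type*} [MeasurableSpace Ω] [MeasurableSpace O]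
    (ε δ : ℝ) (P : Measure Ω) (A : Stream d T → Ω → O) : Prop :=
  ∀ x y : Stream d T, Neighboring x y → ∀ S : Set O, MeasurableSet S →
    P {ω | A x ω ∈ S} ≤ ENNReal.ofReal (Real.exp ε) * P {ω | A y ω ∈ S} + ENNReal.ofReal δ

/-- The Laplace distribution centered at `0` with scale `b`. -/
def laplace (b : ℝ) : Measure ℝ :=
  volume.withDensity fun x => ENNReal.ofReal (1 / (2 * b) * Real.exp (-|x| / b))

/-! ### Histogram mechanisms and the adaptive continual release model -/

/-- A randomized online mechanism with inputs in `ℕ^d` and outputs in `ℝ^d`, whose random coins are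
drawn from the probability measure `law`. If the inputs so far are `v₁, …, vₙ`, then the output
after the `n`-th input is `out ω [v₁, …, vₙ]`, where `ω` are the coins. -/
structure HistogramMechanism (d : ℕ) (Ω : Type*) [MeasurableSpace Ω] where
  law : Measure Ω
  isProbabilityMeasure_law : IsProbabilityMeasure law
  out : Ω → List (Fin d → ℕ) → (Fin d → ℝ)
  measurable_out : ∀ l, Measurable fun ω => out ω l

/-- The side of the privacy game. -/
inductive Side
  | L
  | R

/-- What the adversary outputs in one round: one input, or a challenge pair of inputs. -/
inductive Move (d : ℕ)
  | regular (v : Fin d → ℕ)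
  | challenge (vL vR : Fin d → ℕ)

namespace Move

variable {d : ℕ}

/-- The input that is sent to the mechanism. -/
def sent : Move d → Side → (Fin d → ℕ)
  | regular v, _ => v
  | challenge vL _, Side.L => vL
  | challenge _ vR, Side.R => vR

/-- The round is a challenge round. -/
def IsChallenge : Move d → Prop
  | regular _ => False
  | challenge _ _ => True

/-- The two inputs of a challenge differ by at most `1` in every coordinate. -/
def Valid : Move d → Prop
  | regular _ => True
  | challenge vL vR => ∀ i, |(vL i : ℤ) - (vR i : ℤ)| ≤ 1

instance : MeasurableSpace (Move d) := ⊤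

instance : DiscreteMeasurableSpace (Move d) := ⟨fun _ => trivial⟩

instance : Countable (Move d) := by
  let f : Move d → (Fin d → ℕ) ⊕ ((Fin d → ℕ) × (Fin d → ℕ)) := fun m =>
    match m with
    | regular v => Sum.inl v
    | challenge vL vR => Sum.inr (vL, vR)
  have hf : Function.Injective f := by
    intro a b h
    cases a <;> cases b <;> simp_all [f]
  exact hf.countable

end Move

/-- The first `n` entries of a sequence of length `N`. -/
def firstEntries {α : Type*} {N : ℕ} (a : Fin N → α) (n : Fin N) : Fin (n : ℕ) → α :=
  fun i => a (Fin.castLE n.isLt.le i)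

/-- A randomized adversary in the game with `N` rounds. `move n ω a` is its output after `n` rounds
in which its coins are `ω` and the mechanism has answered `a`. In every run exactly one of the
rounds is a challenge. -/
structure Adversary (d N : ℕ) (Ω : Type*) [MeasurableSpace Ω] where
  law : Measure Ω
  isProbabilityMeasure_law : IsProbabilityMeasure law
  move : (n : ℕ) → Ω → (Fin n → Fin d → ℝ) → Move d
  measurable_move : ∀ n, Measurable fun p : Ω × (Fin n → Fin d → ℝ) => move n p.1 p.2
  valid_move : ∀ n ω a, (move n ω a).Valid
  existsUnique_challenge : ∀ (ω : Ω) (a : Fin N → Fin d → ℝ),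
    ∃! n : Fin N, (move n ω (firstEntries a n)).IsChallenge

/-- The first `n` rounds of the privacy game: the inputs received by the mechanism (in order), and
the answers of the mechanism. -/
def play {d N : ℕ} {Ω Ω' : Type*} [MeasurableSpace Ω] [MeasurableSpace Ω']
    (M : HistogramMechanism d Ω) (A : Adversary d N Ω') (side : Side) (ω : Ω) (ω' : Ω') :
    (n : ℕ) → List (Fin d → ℕ) × (Fin n → Fin d → ℝ)
  | 0 => ([], Fin.elim0)
  | n + 1 =>
    let p := play M A side ω ω' n
    let inputs := p.1 ++ [(A.move n ω' p.2).sent side]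
    (inputs, Fin.snoc (α := fun _ => Fin d → ℝ) p.2 (M.out ω inputs))

/-- The view of the adversary after `N` rounds: its coins, its own outputs, and the answers of the
mechanism. -/
def view {d N : ℕ} {Ω Ω' : Type*} [MeasurableSpace Ω] [MeasurableSpace Ω']
    (M : HistogramMechanism d Ω) (A : Adversary d N Ω') (side : Side) (ω : Ω) (ω' : Ω') :
    Ω' × (Fin N → Move d) × (Fin N → Fin d → ℝ) :=
  let a := (play M A side ω ω' N).2
  (ω', fun n => A.move n ω' (firstEntries a n), a)

/-- `M`, run for `N` rounds, is `(ε, δ)`-differentially private in the adaptive continual release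
model. -/
def AdaptivelyDP {d : ℕ} {Ω : Type*} [MeasurableSpace Ω]
    (M : HistogramMechanism d Ω) (N : ℕ) (ε δ : ℝ) : Prop :=
  ∀ (Ω' : Type) [MeasurableSpace Ω'] (A : Adversary d N Ω')
    (S : Set (Ω' × (Fin N → Move d) × (Fin N → Fin d → ℝ))), MeasurableSet S →
    (M.law.prod A.law) {p | view M A Side.L p.1 p.2 ∈ S} ≤
        ENNReal.ofReal (Real.exp ε) * (M.law.prod A.law) {p | view M A Side.R p.1 p.2 ∈ S}
          + ENNReal.ofReal δ ∧
    (M.law.prod A.law) {p | view M A Side.R p.1 p.2 ∈ S} ≤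
        ENNReal.ofReal (Real.exp ε) * (M.law.prod A.law) {p | view M A Side.L p.1 p.2 ∈ S}
          + ENNReal.ofReal δ

/-! ### Queries -/

/-- Monotone histogram queries with sensitivity `1`. The mechanism evaluates them on noisy
histograms too, so they are functions on `ℝ^d`. -/
structure IsMonotoneHistogramQuery {d : ℕ} (g : (Fin d → ℝ) → ℝ) : Prop where
  /-- Monotone in time along every stream of rows in `{0,1}^d`. -/
  monotone : ∀ (v : Fin d → ℕ) (u : Fin d → Bool), g (toReal v) ≤ g (toReal (v + rowNat u))
  sensitivity : ∀ v w : Fin d → ℝ, (∀ i, |v i - w i| ≤ 1) → |g v - g w| ≤ 1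
  map_zero : g 0 = 0

/-! ### The partitioning mechanism for `k` queries -/

/-- Fresh noise for one time step: `mu` for the test whether to close the interval, and, used only
if the interval is closed, `nu i` for the update of the `i`-th threshold and the new `tau`. -/
structure StepNoise (k : ℕ) where
  mu : ℝ
  nu : Fin k → ℝ
  tau : ℝ

/-- The variables of the mechanism. `threshold i` is the `i`-th threshold without `tau`, and
`inserted` is the list of the inputs inserted into the histogram mechanism so far. -/
structure State (d k : ℕ) where
  j : ℕ
  c : Fin d → ℕ
  s : Fin d → ℝ
  threshold : Fin k → ℝ
  tau : ℝ
  inserted : List (Fin d → ℕ)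
  out : Fin k → ℝ

/-- The setting of the parameters that do not influence privacy: the initial `s`, the initial
thresholds, the amount `K` by which thresholds are raised, and `C`. -/
structure Setting (d k : ℕ) where
  s₀ : Fin d → ℝ
  threshold₀ : Fin k → ℝ
  K : ℝ
  C : ℝ

open Classical in
/-- One time step, with input row `u`, partition bound `Δ`, and coins `ω` of the histogram
mechanism `H`. -/
def step {d k : ℕ} {Ω : Type*} [MeasurableSpace Ω] (H : HistogramMechanism d Ω)
    (g : Fin k → (Fin d → ℝ) → ℝ) (Δ : ℕ) (p : Setting d k) (ω : Ω)
    (u : Fin d → Bool) (z : StepNoise k) (σ : State d k) : State d k :=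
  let c := σ.c + rowNat u
  let s := σ.s + toReal (rowNat u)
  if (∃ i, g i s + z.mu > σ.threshold i + σ.tau) ∧ σ.j ≤ Δ then
    let inserted := σ.inserted ++ [c]
    let s' := H.out ω inserted
    { j := σ.j + 1
      c := 0
      s := s'
      threshold := fun i =>
        if g i s + z.nu i > σ.threshold i - p.C then σ.threshold i + p.K else σ.threshold i
      tau := z.tau
      inserted := inserted
      out := fun i => g i s' }
  else { σ with c := c, s := s }

/-- The coins of the mechanism: the coins of `H`, the first `tau`, and for every time step the
noises `(mu, nu, tau)`. -/
abbrev Coins (k T : ℕ) (Ω : Type*) : Type _ :=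
  Ω × ℝ × (Fin T → ℝ × (Fin k → ℝ) × ℝ)

/-- The state after `n` time steps (`n ≤ T`). -/
def stateAfter {d k T : ℕ} {Ω : Type*} [MeasurableSpace Ω] (H : HistogramMechanism d Ω)
    (g : Fin k → (Fin d → ℝ) → ℝ) (Δ : ℕ) (p : Setting d k) (x : Stream d T)
    (r : Coins k T Ω) : ℕ → State d k
  | 0 =>
    { j := 1
      c := 0
      s := p.s₀
      threshold := p.threshold₀
      tau := r.2.1
      inserted := []
      out := fun i => g i 0 }
  | n + 1 =>
    if h : n < T then
      let z := r.2.2 ⟨n, h⟩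
      step H g Δ p r.1 (x ⟨n, h⟩) ⟨z.1, z.2.1, z.2.2⟩ (stateAfter H g Δ p x r n)
    else stateAfter H g Δ p x r n

/-- The mechanism: the sequence of its outputs at the time steps `1, …, T`. -/
def kQueryMechanism {d k T : ℕ} {Ω : Type*} [MeasurableSpace Ω] (H : HistogramMechanism d Ω)
    (g : Fin k → (Fin d → ℝ) → ℝ) (Δ : ℕ) (p : Setting d k) (x : Stream d T)
    (r : Coins k T Ω) : Fin T → Fin k → ℝ :=
  fun t => (stateAfter H g Δ p x r (t + 1)).out

/-- The variance `18 k ln(4 e^{2ε/3} / δ) / ε²` of the noise in the threshold updates. -/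
def updateVariance (k : ℕ) (ε δ : ℝ) : ℝ :=
  18 * k * Real.log (4 * Real.exp (2 * ε / 3) / δ) / ε ^ 2

/-- The law of the coins: all noises are independent, `tau ∼ Lap(6/ε)`, `mu ∼ Lap(12/ε)`, and the
noises `nu i` are centered Gaussian with variance `updateVariance k ε δ`. -/
def coinLaw {d : ℕ} (k T : ℕ) {Ω : Type*} [MeasurableSpace Ω] (H : HistogramMechanism d Ω)
    (ε δ : ℝ) : Measure (Coins k T Ω) :=
  H.law.prod ((laplace (6 / ε)).prod (Measure.pi fun _ =>
    (laplace (12 / ε)).prod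
      ((Measure.pi fun _ => gaussianReal 0 (updateVariance k ε δ).toNNReal).prod
        (laplace (6 / ε)))))

/-! ### The setting of the parameters in the mechanism -/

def alphaSV (k cmax T : ℕ) (ε β : ℝ) : ℝ :=
  12 * ε⁻¹ * (Real.log (6 * (k * cmax) / β) + Real.log (6 * T / β))

def alphaU (k cmax : ℕ) (ε δ β : ℝ) : ℝ :=
  6 * ε⁻¹ * √(k * Real.log (12 * Real.exp (2 * ε / 3) * k * cmax / (β * δ)))

/-- `s = 0`, `C = α_SV + α_U`, `K = 3 (C + err(k c_max))`, and all initial thresholds equal `K`. -/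
def standardSetting (d k cmax T : ℕ) (ε δ β : ℝ) (err : ℕ → ℝ) : Setting d k :=
  let C := alphaSV k cmax T ε β + alphaU k cmax ε δ β
  let K := 3 * (C + err (k * cmax))
  { s₀ := 0
    threshold₀ := fun _ => K
    K := K
    C := C }

end KQuery

end

open MeasureTheory ProbabilityTheory
open scoped ENNReal

namespace KQuery

/-! ### Laplace and Gaussian noise -/

/-! The input stream affects a run in three places only: the test whether to close the interval, the
noisy queries that update the thresholds, and the vectors inserted into `H`. Let `P x₁ x₂ x₃` be the
probability of the output event when these places read the streams `x₁`, `x₂`, `x₃`. The mechanism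
is the diagonal case, and for neighbors `x`, `y` the proof passes through `P x x x`, `P x x y`, `P x
y y`, `P y y y`, at a factor `e^{ε/3}` per exchange. The setting enters only the initial state and
the threshold updates, by the same rule for both streams, so no exchange depends on it.

Exchange at `H`: an adversary draws all noise outside `H` itself and simulates the rest. Given the
answers, the two runs close at the same times and have the same outputs; their inserted vectors
differ at most in the one that covers the differing row, by at most `1` per coordinate. That vector
is the challenge, and the output is a function of the view (`measure_hist_le_of_adaptivelyDP`).

The other two exchanges hold for fixed coins of `H`, that is, for a deterministic oracle. Closing an
interval replaces the working histogram by an answer of the oracle, so the differing row is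
forgotten at the first closing at or after its time. Hence only one threshold update is affected,
which costs one Gaussian mechanism with `k` coordinates (`value_le_of_update_stream`), and only one
interval is tested differently. The latter is the sparse vector argument (`setLIntegral_value_le`):
raising `tau` by `1` keeps the interval open wherever it was open, and raising `mu` by `2` at the
closing step restores the closing; each shift costs `e^{ε/6}`.

Composition gives the factor `e^ε`. The additive terms are `δ / (2 e^{2ε/3})` from `H` and `e^{ε/3}
e^{ε/6} δ / (4 e^{2ε/3})` from the Gaussian step, together at most `3δ/4`. -/

theorem isProbabilityMeasure_laplace {b : ℝ} (hb : 0 < b) : IsProbabilityMeasure (laplace b) := by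
  constructor
  have h1 : ∫ x : ℝ, Real.exp (-|x| / b) = 2 * b := by
    have h2 := integral_comp_abs (f := fun x => Real.exp (-x / b))
    have h3 : ∫ x in Set.Ioi (0 : ℝ), Real.exp (-x / b) = b := by
      have := integral_exp_mul_Ioi (a := -b⁻¹) (by simpa using hb) 0
      simp only [mul_zero, Real.exp_zero] at this
      rw [← neg_neg b, ← inv_inv b, ← inv_neg]
      convert this using 1
      · congr 1; ext x; congr 1; field_simp
      · field_simp
    rw [h2, h3]
  have hint : Integrable fun x : ℝ => Real.exp (-|x| / b) :=
    Integrable.of_integral_ne_zero (by rw [h1]; positivity)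
  rw [laplace, withDensity_apply _ MeasurableSet.univ, Measure.restrict_univ,
    ← ofReal_integral_eq_lintegral_ofReal (hint.const_mul _)
      (Filter.Eventually.of_forall fun x => by positivity), integral_const_mul, h1]
  rw [one_div_mul_cancel (by positivity), ENNReal.ofReal_one]

/-- By the triangle inequality, translation by `c` changes the exponent `-|x| / b` of the density by
at most `|c| / b`. -/
theorem lintegral_laplace_add_le {b : ℝ} (hb : 0 < b) (c : ℝ) {f : ℝ → ℝ≥0∞} (hf : Measurable f) :
    ∫⁻ x, f (x + c) ∂laplace b ≤
      ENNReal.ofReal (Real.exp (|c| / b)) * ∫⁻ x, f x ∂laplace b := by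
  have hm : Measurable fun x : ℝ => ENNReal.ofReal (1 / (2 * b) * Real.exp (-|x| / b)) := by
    fun_prop
  rw [laplace, lintegral_withDensity_eq_lintegral_mul _ hm hf,
    lintegral_withDensity_eq_lintegral_mul _ hm (show Measurable fun x => f (x + c) by fun_prop),
    ← lintegral_const_mul _ (hm.mul hf)]
  -- Translation invariance of Lebesgue measure, applied to the right side only, makes `f (x + c)` a
  -- common factor of both integrands.
  rw [← lintegral_add_right_eq_self (μ := volume) (fun x : ℝ => _ * _) c]
  refine lintegral_mono fun x => ?_
  simp only [Pi.mul_apply]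
  rw [← mul_assoc, ← ENNReal.ofReal_mul (by positivity)]
  gcongr ENNReal.ofReal ?_ * _
  rw [mul_left_comm, ← Real.exp_add]
  gcongr
  rw [← add_div]
  gcongr
  have := abs_add_le x c
  linarith

theorem laplace_le_of_add_mem {b : ℝ} (hb : 0 < b) (c : ℝ) {A B : Set ℝ} (hB : MeasurableSet B)
    (h : ∀ x ∈ A, x + c ∈ B) :
    laplace b A ≤ ENNReal.ofReal (Real.exp (|c| / b)) * laplace b B := by
  calc laplace b A ≤ laplace b ((· + c) ⁻¹' B) := measure_mono h
    _ = ∫⁻ x, B.indicator 1 (x + c) ∂laplace b := by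
      rw [← lintegral_indicator_one (measurable_add_const c hB)]; rfl
    _ ≤ _ := by
      refine (lintegral_laplace_add_le hb c (measurable_one.indicator hB)).trans ?_
      rw [lintegral_indicator_one hB]

/-- Both integrands have the same marginal in coordinate `i`. This allows the noise of a single time
step to be integrated out separately. -/
theorem lintegral_pi_resample {ι : Type*} [Fintype ι] [DecidableEq ι] {X : ι → Type*}
    [∀ i, MeasurableSpace (X i)]
    (μ : ∀ i, Measure (X i)) [∀ i, IsProbabilityMeasure (μ i)] (i : ι)
    {f : (∀ i, X i) → ℝ≥0∞} (hf : Measurable f) :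
    ∫⁻ x, f x ∂Measure.pi μ = ∫⁻ x, ∫⁻ y, f (Function.update x i y) ∂μ i ∂Measure.pi μ := by
  refine lintegral_eq_of_lmarginal_eq {i} hf ?_ ?_
  · exact (hf.comp measurable_update').lintegral_prod_right'
  · simp [lmarginal_singleton]

theorem gaussian_pi_map_add {k : ℕ} (v : NNReal) (a : Fin k → ℝ) :
    (Measure.pi fun _ : Fin k => gaussianReal 0 v).map (· + a) =
      Measure.pi fun i => gaussianReal (a i) v := by
  have := Measure.pi_map_pi (μ := fun _ : Fin k => gaussianReal 0 v)
    (f := fun i x => x + a i) (fun i => by fun_prop)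
  simp only [gaussianReal_map_add_const, zero_add] at this
  exact this

theorem lintegral_pi_prod {k : ℕ} (μ : Fin k → Measure ℝ) [∀ i, IsProbabilityMeasure (μ i)]
    {f : Fin k → ℝ → ℝ≥0∞} (hf : ∀ i, Measurable (f i)) :
    ∫⁻ x, ∏ i, f i (x i) ∂Measure.pi μ = ∏ i, ∫⁻ x, f i x ∂μ i := by
  have hind : iIndepFun (fun i (x : Fin k → ℝ) => f i (x i)) (Measure.pi μ) :=
    iIndepFun_pi (X := f) (fun i => (hf i).aemeasurable)
  have := lintegral_prod_eq_prod_lintegral_of_indepFun Finset.univ _ hind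
    (fun i => (hf i).comp (measurable_pi_apply i))
  refine this.trans (Finset.prod_congr rfl fun i _ => ?_)
  rw [← lintegral_map (hf i) (measurable_pi_apply i), measurePreserving_eval _ i |>.map_eq]

/-- The likelihood ratio of two Gaussians of equal variance; its logarithm is the privacy loss,
affine in `y`. -/
theorem gaussianReal_eq_withDensity {v : NNReal} (hv : v ≠ 0) (m h : ℝ) :
    gaussianReal (m + h) v = (gaussianReal m v).withDensity fun y =>
      ENNReal.ofReal (Real.exp ((h * (y - m) - h ^ 2 / 2) / v)) := by
  rw [gaussianReal_of_var_ne_zero _ hv, gaussianReal_of_var_ne_zero _ hv,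
    ← withDensity_mul _ (measurable_gaussianPDF _ _) (by fun_prop)]
  congr 1
  ext y
  simp only [gaussianPDF, Pi.mul_apply]
  rw [← ENNReal.ofReal_mul (gaussianPDFReal_nonneg _ _ _)]
  congr 1
  simp only [gaussianPDFReal, mul_assoc]
  rw [← Real.exp_add]
  congr 2
  have : (v : ℝ) ≠ 0 := by exact_mod_cast hv
  field_simp
  ring

theorem gaussian_pi_eq_withDensity {k : ℕ} {v : NNReal} (hv : v ≠ 0) (m h : Fin k → ℝ) :
    (Measure.pi fun i => gaussianReal (m i + h i) v) =
      (Measure.pi fun i => gaussianReal (m i) v).withDensity fun y =>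
        ENNReal.ofReal (Real.exp (∑ i, (h i * (y i - m i) - h i ^ 2 / 2) / v)) := by
  refine Measure.pi_eq fun s hs => ?_
  rw [withDensity_apply _ (MeasurableSet.univ_pi hs),
    ← lintegral_indicator (MeasurableSet.univ_pi hs)]
  have : ∀ y : Fin k → ℝ, (Set.univ.pi s).indicator (fun y => ENNReal.ofReal
      (Real.exp (∑ i, (h i * (y i - m i) - h i ^ 2 / 2) / v))) y =
      ∏ i, (s i).indicator (fun y =>
        ENNReal.ofReal (Real.exp ((h i * (y - m i) - h i ^ 2 / 2) / v))) (y i) := by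
    intro y
    by_cases hy : y ∈ Set.univ.pi s
    · rw [Set.indicator_of_mem hy, Real.exp_sum,
        ENNReal.ofReal_prod_of_nonneg fun _ _ => by positivity]
      exact Finset.prod_congr rfl fun i _ => by rw [Set.indicator_of_mem (hy i trivial)]
    · rw [Set.indicator_of_notMem hy]
      simp only [Set.mem_pi, Set.mem_univ, true_implies, not_forall] at hy
      obtain ⟨i, hi⟩ := hy
      exact (Finset.prod_eq_zero (Finset.mem_univ i) (Set.indicator_of_notMem hi _)).symm
  simp_rw [this]
  rw [lintegral_pi_prod _ fun i => Measurable.indicator (by fun_prop) (hs i)]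
  refine Finset.prod_congr rfl fun i _ => ?_
  rw [lintegral_indicator (hs i), gaussianReal_eq_withDensity hv, withDensity_apply _ (hs i)]

/-- Chernoff's bound: the exponential moment factors over the coordinates into Gaussian moment
generating functions. The parameter `s` is left free, to be optimized by the caller. -/
theorem gaussian_pi_tail {k : ℕ} (v : NNReal) (h : Fin k → ℝ) (s t : ℝ) (hs : 0 ≤ s) :
    (Measure.pi fun _ : Fin k => gaussianReal 0 v) {y | t < ∑ i, h i * y i} ≤
      ENNReal.ofReal (Real.exp (-(s * t) + v * s ^ 2 * (∑ i, h i ^ 2) / 2)) := by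
  have h1 : ∫⁻ y, ENNReal.ofReal (Real.exp (s * ∑ i, h i * y i))
      ∂(Measure.pi fun _ : Fin k => gaussianReal 0 v) =
      ENNReal.ofReal (Real.exp (v * s ^ 2 * (∑ i, h i ^ 2) / 2)) := by
    have : ∀ y : Fin k → ℝ, ENNReal.ofReal (Real.exp (s * ∑ i, h i * y i)) =
        ∏ i, ENNReal.ofReal (Real.exp ((s * h i) * y i)) := by
      intro y
      rw [← ENNReal.ofReal_prod_of_nonneg fun _ _ => by positivity, ← Real.exp_sum, Finset.mul_sum]
      simp only [mul_assoc]
    simp_rw [this]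
    rw [lintegral_pi_prod _ (f := fun i y => ENNReal.ofReal (Real.exp ((s * h i) * y)))
      fun i => by fun_prop]
    have h2 : ∀ i, ∫⁻ y, ENNReal.ofReal (Real.exp ((s * h i) * y)) ∂gaussianReal 0 v =
        ENNReal.ofReal (Real.exp (v * (s * h i) ^ 2 / 2)) := by
      intro i
      rw [← ofReal_integral_eq_lintegral_ofReal (integrable_exp_mul_gaussianReal _)
        (Filter.Eventually.of_forall fun x => by positivity)]
      have := congrFun (mgf_id_gaussianReal (μ := 0) (v := v)) (s * h i)
      simp only [mgf, id, zero_mul, zero_add] at this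
      rw [this]
    simp_rw [h2]
    rw [← ENNReal.ofReal_prod_of_nonneg fun _ _ => by positivity, ← Real.exp_sum]
    congr 2
    rw [← Finset.sum_div, Finset.mul_sum]
    congr 1
    exact Finset.sum_congr rfl fun i _ => by ring
  calc _ ≤ ∫⁻ y, ENNReal.ofReal (Real.exp (-(s * t))) *
        ENNReal.ofReal (Real.exp (s * ∑ i, h i * y i))
        ∂(Measure.pi fun _ : Fin k => gaussianReal 0 v) := by
        rw [← lintegral_indicator_one (measurableSet_lt (by fun_prop) (by fun_prop))]
        refine lintegral_mono fun y => ?_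
        refine Set.indicator_apply_le' (fun hy => ?_) fun _ => zero_le
        rw [← ENNReal.ofReal_mul (by positivity), ← Real.exp_add, Pi.one_apply,
          ENNReal.one_le_ofReal, Real.one_le_exp_iff]
        have := mul_le_mul_of_nonneg_left (le_of_lt hy) hs
        linarith
    _ = _ := by
        rw [lintegral_const_mul _ (by fun_prop), h1, ← ENNReal.ofReal_mul (by positivity),
          ← Real.exp_add]

/-- The Gaussian mechanism with `k` coordinates, each of sensitivity `1`. -/
theorem gaussian_pi_shift_le {k : ℕ} {v : NNReal} (hv : v ≠ 0) {e : ℝ} (he : 0 ≤ e)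
    {a b : Fin k → ℝ} (hab : ∀ i, |a i - b i| ≤ 1) {f : (Fin k → ℝ) → ℝ≥0∞} (hf : Measurable f)
    (hf1 : ∀ y, f y ≤ 1) :
    ∫⁻ y, f (y + a) ∂(Measure.pi fun _ : Fin k => gaussianReal 0 v) ≤
      ENNReal.ofReal (Real.exp e) *
          ∫⁻ y, f (y + b) ∂(Measure.pi fun _ : Fin k => gaussianReal 0 v) +
        ENNReal.ofReal (Real.exp (e / 2 - e ^ 2 * v / (2 * k))) := by
  set P := Measure.pi fun _ : Fin k => gaussianReal 0 v with hP
  set h := a - b with hh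
  set ρ : (Fin k → ℝ) → ℝ := fun y => ∑ i, (h i * (y i - b i) - h i ^ 2 / 2) / v with hρ
  have hρm : Measurable ρ := by fun_prop
  -- `ρ` is the privacy loss. On `G` the likelihood ratio is at most `e^e`; the complement is paid
  -- for by its probability, since `f ≤ 1`.
  set G : Set (Fin k → ℝ) := {y | ρ y ≤ e} with hG
  have hGm : MeasurableSet G := measurableSet_le hρm measurable_const
  have hPa : P.map (· + a) = (P.map (· + b)).withDensity fun y =>
      ENNReal.ofReal (Real.exp (ρ y)) := by
    rw [hP, gaussian_pi_map_add, gaussian_pi_map_add, ← gaussian_pi_eq_withDensity hv]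
    simp [hh]
  have hh2 : ∑ i, h i ^ 2 ≤ k := by
    calc ∑ i, h i ^ 2 ≤ ∑ _i : Fin k, (1 : ℝ) := Finset.sum_le_sum fun i _ => by
          have := hab i
          rw [hh, Pi.sub_apply, sq_le_one_iff_abs_le_one]; exact this
      _ = k := by simp
  have hv0 : (0 : ℝ) < v := by positivity
  have hbad : P.map (· + a) Gᶜ ≤ ENNReal.ofReal (Real.exp (e / 2 - e ^ 2 * v / (2 * k))) := by
    rw [Measure.map_apply (by fun_prop) hGm.compl]
    -- For `k = 0` the loss vanishes identically, and the Chernoff parameter `e / k` would be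
    -- meaningless.
    rcases Nat.eq_zero_or_pos k with rfl | hk
    · have : (· + a) ⁻¹' Gᶜ = ∅ := by
        ext y; simp [hG, hρ, he]
      rw [this, measure_empty]
      exact zero_le
    have hk' : (0 : ℝ) < k := by exact_mod_cast hk
    calc _ ≤ P {y | e * v - (∑ i, h i ^ 2) / 2 < ∑ i, h i * y i} := by
          refine measure_mono fun y hy => ?_
          simp only [hG, Set.mem_preimage, Set.mem_compl_iff, Set.mem_ofPred_eq, not_le, hρ] at hy ⊢
          rw [← Finset.sum_div, lt_div_iff₀ hv0, Finset.sum_sub_distrib, ← Finset.sum_div] at hy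
          have : ∑ i, h i * ((y + a) i - b i) = ∑ i, h i * y i + ∑ i, h i ^ 2 := by
            rw [← Finset.sum_add_distrib]
            exact Finset.sum_congr rfl fun i _ => by
              simp only [hh, Pi.add_apply, Pi.sub_apply]
              ring
          rw [this] at hy
          linarith
      -- `s = e / k` minimizes `-s e v + v s² k / 2`, the leading part of the exponent when `∑ h i ^
      -- 2` is replaced by its bound `k`.
      _ ≤ _ := gaussian_pi_tail v h (e / k) _ (by positivity)
      _ ≤ _ := by
          gcongr
          have h3 : (e / k) * (∑ i, h i ^ 2) / 2 ≤ e / 2 := by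
            have := mul_le_mul_of_nonneg_left hh2 (show 0 ≤ e / k by positivity)
            rw [div_mul_cancel₀ _ hk'.ne'] at this
            linarith
          have h4 : v * (e / k) ^ 2 * (∑ i, h i ^ 2) / 2 ≤ e ^ 2 * v / (2 * k) := by
            have := mul_le_mul_of_nonneg_left hh2 (show 0 ≤ v * (e / k) ^ 2 by positivity)
            calc _ ≤ v * (e / k) ^ 2 * k / 2 := by linarith
              _ = _ := by field_simp
          have h5 : e / k * (e * v) = 2 * (e ^ 2 * v / (2 * k)) := by field_simp
          linarith
  rw [← lintegral_map hf (measurable_add_const a), ← lintegral_map hf (measurable_add_const b),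
    ← lintegral_add_compl _ hGm]
  gcongr
  · rw [hPa, restrict_withDensity hGm,
      lintegral_withDensity_eq_lintegral_mul _ (by fun_prop) hf, ← lintegral_const_mul _ hf]
    calc _ ≤ ∫⁻ y in G, ENNReal.ofReal (Real.exp e) * f y ∂P.map (· + b) :=
          setLIntegral_mono (by fun_prop) fun y hy => by
            simp only [Pi.mul_apply]
            gcongr
            exact hy
      _ ≤ _ := setLIntegral_le_lintegral _ _
  · calc _ ≤ ∫⁻ y in Gᶜ, 1 ∂P.map (· + a) := lintegral_mono fun y => hf1 y
      _ ≤ _ := by simpa using hbad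

/-! ### The hybrid mechanisms -/

/-- There are only countably many input lists, so with the discrete σ-algebra measurability can be
checked list by list. -/
instance (d : ℕ) : MeasurableSpace (List (Fin d → ℕ)) := ⊤

instance (d : ℕ) : DiscreteMeasurableSpace (List (Fin d → ℕ)) := ⟨fun _ => trivial⟩

/-- The noise `(mu, nu, tau)` of one time step. -/
abbrev Noise (k : ℕ) : Type := ℝ × (Fin k → ℝ) × ℝ

/-- The variables of a mechanism that uses one stream (through `s`) in the test whether to close
the interval, one stream (through `q`) in the updates of the thresholds, and one stream (through
`c`) for the inputs of the histogram mechanism. Moreover, `hist t` is the output at time `t`. -/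
structure HybridState (d k : ℕ) where
  ins : List (Fin d → ℕ)
  c : Fin d → ℕ
  s : Fin d → ℝ
  q : Fin d → ℝ
  thr : Fin k → ℝ
  tau : ℝ
  out : Fin k → ℝ
  hist : ℕ → Fin k → ℝ

namespace HybridState

variable {d k : ℕ}

/-- The state as a tuple. -/
def toTuple (σ : HybridState d k) : List (Fin d → ℕ) × (Fin d → ℕ) × (Fin d → ℝ) × (Fin d → ℝ) ×
    (Fin k → ℝ) × ℝ × (Fin k → ℝ) × (ℕ → Fin k → ℝ) :=
  (σ.ins, σ.c, σ.s, σ.q, σ.thr, σ.tau, σ.out, σ.hist)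

instance : MeasurableSpace (HybridState d k) := MeasurableSpace.comap toTuple inferInstance

theorem measurable_toTuple : Measurable (toTuple : HybridState d k → _) := comap_measurable _

@[fun_prop]
theorem measurable_ins : Measurable (ins : HybridState d k → _) := measurable_toTuple.fst

@[fun_prop]
theorem measurable_c : Measurable (c : HybridState d k → _) := measurable_toTuple.snd.fst

@[fun_prop]
theorem measurable_s : Measurable (s : HybridState d k → _) := measurable_toTuple.snd.snd.fst

@[fun_prop]
theorem measurable_q : Measurable (q : HybridState d k → _) := measurable_toTuple.snd.snd.snd.fst

@[fun_prop]
theorem measurable_thr : Measurable (thr : HybridState d k → _) :=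
  measurable_toTuple.snd.snd.snd.snd.fst

@[fun_prop]
theorem measurable_tau : Measurable (tau : HybridState d k → _) :=
  measurable_toTuple.snd.snd.snd.snd.snd.fst

@[fun_prop]
theorem measurable_out : Measurable (out : HybridState d k → _) :=
  measurable_toTuple.snd.snd.snd.snd.snd.snd.fst

@[fun_prop]
theorem measurable_hist : Measurable (hist : HybridState d k → _) :=
  measurable_toTuple.snd.snd.snd.snd.snd.snd.snd

@[fun_prop]
theorem measurable_mk {Θ : Type*} [MeasurableSpace Θ] {ins : Θ → List (Fin d → ℕ)}
    {c : Θ → Fin d → ℕ} {s q : Θ → Fin d → ℝ} {thr : Θ → Fin k → ℝ} {tau : Θ → ℝ}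
    {out : Θ → Fin k → ℝ} {hist : Θ → ℕ → Fin k → ℝ} (h1 : Measurable ins) (h2 : Measurable c)
    (h3 : Measurable s) (h4 : Measurable q) (h5 : Measurable thr) (h6 : Measurable tau)
    (h7 : Measurable out) (h8 : Measurable hist) :
    Measurable fun θ => HybridState.mk (ins θ) (c θ) (s θ) (q θ) (thr θ) (tau θ) (out θ)
      (hist θ) := by
  rw [measurable_comap_iff]
  exact h1.prodMk (h2.prodMk (h3.prodMk (h4.prodMk (h5.prodMk (h6.prodMk (h7.prodMk h8))))))

/-- The state after a time step in which the interval is not closed. -/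
def carry (σ : HybridState d k) (n : ℕ) (u₁ u₂ u₃ : Fin d → Bool) : HybridState d k :=
  { σ with
    c := σ.c + rowNat u₃
    s := σ.s + toReal (rowNat u₁)
    q := σ.q + toReal (rowNat u₂)
    hist := Function.update σ.hist n σ.out }

open Classical in
/-- The state after a time step in which the interval is closed, the noisy values of the queries
for the updates of the thresholds are `y.1`, and the new `tau` is `y.2`. -/
noncomputable def reset (o : List (Fin d → ℕ) → Fin d → ℝ) (g : Fin k → (Fin d → ℝ) → ℝ)
    (p : Setting d k) (σ : HybridState d k) (n : ℕ) (u₃ : Fin d → Bool) (y : (Fin k → ℝ) × ℝ) :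
    HybridState d k :=
  let ins := σ.ins ++ [σ.c + rowNat u₃]
  let s := o ins
  { ins := ins
    c := 0
    s := s
    q := s
    thr := fun i => if y.1 i > σ.thr i - p.C then σ.thr i + p.K else σ.thr i
    tau := y.2
    out := fun i => g i s
    hist := Function.update σ.hist n (fun i => g i s) }

/-- The state after a time step in which the interval is closed. -/
noncomputable def close (o : List (Fin d → ℕ) → Fin d → ℝ) (g : Fin k → (Fin d → ℝ) → ℝ)
    (p : Setting d k) (σ : HybridState d k) (n : ℕ) (u₂ u₃ : Fin d → Bool)
    (z : (Fin k → ℝ) × ℝ) : HybridState d k :=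
  -- The stream for the updates enters only as a translation of the noise vector, so exchanging it
  -- amounts to shifting a Gaussian.
  σ.reset o g p n u₃ (z.1 + fun i => g i (σ.q + toReal (rowNat u₂)), z.2)

/-- The test whether to close the interval. -/
def Closes (g : Fin k → (Fin d → ℝ) → ℝ) (Δ : ℕ) (σ : HybridState d k) (u₁ : Fin d → Bool)
    (mu : ℝ) : Prop :=
  (∃ i, g i (σ.s + toReal (rowNat u₁)) + mu > σ.thr i + σ.tau) ∧ σ.ins.length < Δ

open Classical in
/-- One time step. -/
noncomputable def next (o : List (Fin d → ℕ) → Fin d → ℝ) (g : Fin k → (Fin d → ℝ) → ℝ) (Δ : ℕ)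
    (p : Setting d k) (n : ℕ) (u₁ u₂ u₃ : Fin d → Bool) (z : Noise k) (σ : HybridState d k) :
    HybridState d k :=
  if σ.Closes g Δ u₁ z.1 then σ.close o g p n u₂ u₃ z.2 else σ.carry n u₁ u₂ u₃

/-- The initial state. -/
def init (g : Fin k → (Fin d → ℝ) → ℝ) (p : Setting d k) (tau : ℝ) : HybridState d k :=
  { ins := []
    c := 0
    s := p.s₀
    q := p.s₀
    thr := p.threshold₀
    tau := tau
    out := fun i => g i 0
    hist := fun _ => 0 }

/-- The state after `n` time steps (`n ≤ T`). -/
noncomputable def run {T : ℕ} (o : List (Fin d → ℕ) → Fin d → ℝ) (g : Fin k → (Fin d → ℝ) → ℝ)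
    (Δ : ℕ) (p : Setting d k) (x₁ x₂ x₃ : ℕ → Fin d → Bool) (tau : ℝ) (zs : Fin T → Noise k) :
    ℕ → HybridState d k
  | 0 => init g p tau
  | n + 1 =>
    if h : n < T then
      next o g Δ p n (x₁ n) (x₂ n) (x₃ n) (zs ⟨n, h⟩) (run o g Δ p x₁ x₂ x₃ tau zs n)
    else run o g Δ p x₁ x₂ x₃ tau zs n

/-! ### Measurability of the hybrid mechanisms. -/

variable {Θ : Type*} [MeasurableSpace Θ] {g : Fin k → (Fin d → ℝ) → ℝ}

@[fun_prop]
theorem measurable_update_hist {f : Θ → ℕ → Fin k → ℝ} {y : Θ → Fin k → ℝ} (hf : Measurable f)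
    (hy : Measurable y) (n : ℕ) : Measurable fun θ => Function.update (f θ) n (y θ) :=
  measurable_update'.comp (hf.prodMk hy)

@[fun_prop]
theorem measurable_carry {σ : Θ → HybridState d k} (hσ : Measurable σ) (n : ℕ)
    (u₁ u₂ u₃ : Fin d → Bool) : Measurable fun θ => (σ θ).carry n u₁ u₂ u₃ := by
  unfold carry
  fun_prop

theorem measurable_oracle {o : Θ → List (Fin d → ℕ) → Fin d → ℝ}
    (ho : ∀ l, Measurable fun θ => o θ l)
    {l : Θ → List (Fin d → ℕ)} (hl : Measurable l) : Measurable fun θ => o θ (l θ) := by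
  have : Measurable fun q : List (Fin d → ℕ) × Θ => o q.2 q.1 :=
    measurable_from_prod_countable_right fun l => ho l
  exact this.comp (hl.prodMk measurable_id)

theorem measurable_reset (hg : ∀ i, Measurable (g i)) {o : Θ → List (Fin d → ℕ) → Fin d → ℝ}
    (ho : ∀ l, Measurable fun θ => o θ l) (p : Setting d k) {σ : Θ → HybridState d k}
    (hσ : Measurable σ) (n : ℕ) (u₃ : Fin d → Bool) {y : Θ → (Fin k → ℝ) × ℝ}
    (hy : Measurable y) : Measurable fun θ => (σ θ).reset (o θ) g p n u₃ (y θ) := by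
  have hins : Measurable fun θ => (σ θ).ins ++ [(σ θ).c + rowNat u₃] := by
    have : Measurable fun q : List (Fin d → ℕ) × (Fin d → ℕ) => q.1 ++ [q.2 + rowNat u₃] :=
      measurable_of_countable _
    exact this.comp ((measurable_ins.comp hσ).prodMk (measurable_c.comp hσ))
  have hs := measurable_oracle ho hins
  have hout : Measurable fun θ => fun i => g i (o θ ((σ θ).ins ++ [(σ θ).c + rowNat u₃])) :=
    measurable_pi_iff.2 fun i => (hg i).comp hs
  unfold reset
  refine measurable_mk hins (by fun_prop) hs hs (measurable_pi_iff.2 fun i => ?_) (by fun_prop)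
    hout (measurable_update_hist (by fun_prop) hout n)
  exact Measurable.ite (measurableSet_lt (by fun_prop) (by fun_prop)) (by fun_prop) (by fun_prop)

theorem measurable_close (hg : ∀ i, Measurable (g i)) {o : Θ → List (Fin d → ℕ) → Fin d → ℝ}
    (ho : ∀ l, Measurable fun θ => o θ l) (p : Setting d k) {σ : Θ → HybridState d k}
    (hσ : Measurable σ) (n : ℕ) (u₂ u₃ : Fin d → Bool) {z : Θ → (Fin k → ℝ) × ℝ}
    (hz : Measurable z) : Measurable fun θ => (σ θ).close (o θ) g p n u₂ u₃ (z θ) := by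
  refine measurable_reset hg ho p hσ n u₃ ((hz.fst.add (measurable_pi_iff.2 fun i => ?_)).prodMk
    hz.snd)
  exact (hg i).comp (show Measurable fun θ => (σ θ).q + toReal (rowNat u₂) by fun_prop)

theorem measurableSet_closes (hg : ∀ i, Measurable (g i)) (Δ : ℕ) {σ : Θ → HybridState d k}
    (hσ : Measurable σ) (u₁ : Fin d → Bool) {mu : Θ → ℝ} (hmu : Measurable mu) :
    MeasurableSet {θ | (σ θ).Closes g Δ u₁ (mu θ)} := by
  refine MeasurableSet.inter ?_ ?_
  · have h : MeasurableSet
        (⋃ i, {θ | (σ θ).thr i + (σ θ).tau < g i ((σ θ).s + toReal (rowNat u₁)) + mu θ}) := by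
      refine MeasurableSet.iUnion fun i => measurableSet_lt (by fun_prop) ?_
      have := (hg i).comp (show Measurable fun θ => (σ θ).s + toReal (rowNat u₁) by fun_prop)
      simp only [Function.comp_def] at this
      fun_prop
    rwa [← Set.ofPred_exists] at h
  · exact (measurable_ins.comp hσ) (MeasurableSet.of_discrete (s := {l | l.length < Δ}))

theorem measurable_next (hg : ∀ i, Measurable (g i)) {o : Θ → List (Fin d → ℕ) → Fin d → ℝ}
    (ho : ∀ l, Measurable fun θ => o θ l) (Δ : ℕ) (p : Setting d k) {σ : Θ → HybridState d k}
    (hσ : Measurable σ) (n : ℕ) (u₁ u₂ u₃ : Fin d → Bool) {z : Θ → Noise k}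
    (hz : Measurable z) : Measurable fun θ => next (o θ) g Δ p n u₁ u₂ u₃ (z θ) (σ θ) :=
  Measurable.ite (measurableSet_closes hg Δ hσ u₁ hz.fst)
    (measurable_close hg ho p hσ n u₂ u₃ hz.snd) (by fun_prop)

theorem measurable_run (hg : ∀ i, Measurable (g i)) {o : Θ → List (Fin d → ℕ) → Fin d → ℝ}
    (ho : ∀ l, Measurable fun θ => o θ l) (Δ : ℕ) (p : Setting d k) (x₁ x₂ x₃ : ℕ → Fin d → Bool)
    {tau : Θ → ℝ} (htau : Measurable tau) {T : ℕ} {zs : Θ → Fin T → Noise k} (hzs : Measurable zs)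
    (n : ℕ) : Measurable fun θ => run (o θ) g Δ p x₁ x₂ x₃ (tau θ) (zs θ) n := by
  induction n with
  | zero => unfold run init; fun_prop
  | succ n ih =>
    unfold run
    split_ifs with h
    · exact measurable_next hg ho Δ p ih n _ _ _ (by fun_prop)
    · exact ih

end HybridState

open HybridState

/-- A stream, continued by zero rows. -/
def extend {d T : ℕ} (x : Stream d T) (n : ℕ) : Fin d → Bool :=
  if h : n < T then x ⟨n, h⟩ else fun _ => false

/-- On equal streams `s` and `q` receive the same additions and the same resets. The counter `j` is
one more than the number of insertions, so the test `j ≤ Δ` becomes `ins.length < Δ`. -/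
theorem stateAfter_eq_run {d k T : ℕ} {Ω : Type*} [MeasurableSpace Ω]
    (H : HistogramMechanism d Ω) (g : Fin k → (Fin d → ℝ) → ℝ) (Δ : ℕ) (p : Setting d k)
    (x : Stream d T) (r : Coins k T Ω) (n : ℕ) :
    let σ := run (H.out r.1) g Δ p (extend x) (extend x) (extend x) r.2.1 r.2.2 n
    stateAfter H g Δ p x r n = ⟨σ.ins.length + 1, σ.c, σ.s, σ.thr, σ.tau, σ.ins, σ.out⟩ ∧
      σ.q = σ.s := by
  induction n with
  | zero => simp [stateAfter, run, init]
  | succ n ih =>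
    simp only [stateAfter, run] at ih ⊢
    obtain ⟨h1, h2⟩ := ih
    split_ifs with hn
    · rw [h1]
      simp only [KQuery.step, HybridState.next, Closes, extend, hn, dif_pos, Nat.succ_le_iff]
      split_ifs with hc
      · simp [close, reset, h2, add_comm]
      · simp [carry, h2]
    · exact ⟨h1, h2⟩

theorem hist_run {d k T : ℕ} (o : List (Fin d → ℕ) → Fin d → ℝ)
    (g : Fin k → (Fin d → ℝ) → ℝ) (Δ : ℕ) (p : Setting d k) (x₁ x₂ x₃ : ℕ → Fin d → Bool)
    (tau : ℝ) (zs : Fin T → Noise k) (n : ℕ) (hn : n ≤ T) (t : ℕ) (ht : t < n) :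
    (run o g Δ p x₁ x₂ x₃ tau zs n).hist t = (run o g Δ p x₁ x₂ x₃ tau zs (t + 1)).out := by
  have key : ∀ m (hm : m < T), (run o g Δ p x₁ x₂ x₃ tau zs (m + 1)).hist =
      Function.update (run o g Δ p x₁ x₂ x₃ tau zs m).hist m
        (run o g Δ p x₁ x₂ x₃ tau zs (m + 1)).out := by
    intro m hm
    rw [run, dif_pos hm, HybridState.next]
    split_ifs <;> rfl
  induction n with
  | zero => omega
  | succ n ih =>
    rw [key n hn]
    rcases Nat.lt_succ_iff_lt_or_eq.1 ht with h | rfl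
    · rw [Function.update_of_ne h.ne, ih (by omega) h]
    · rw [Function.update_self]

theorem kQueryMechanism_eq_hist {d k T : ℕ} {Ω : Type*} [MeasurableSpace Ω]
    (H : HistogramMechanism d Ω) (g : Fin k → (Fin d → ℝ) → ℝ) (Δ : ℕ) (p : Setting d k)
    (x : Stream d T) (r : Coins k T Ω) :
    kQueryMechanism H g Δ p x r = fun t : Fin T =>
      (run (H.out r.1) g Δ p (extend x) (extend x) (extend x) r.2.1 r.2.2 T).hist t := by
  ext1 t
  rw [hist_run _ _ _ _ _ _ _ _ _ T le_rfl t t.2, kQueryMechanism, (stateAfter_eq_run ..).1]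

/-! ### Value functions -/

section Value

variable {d k T : ℕ} {o : List (Fin d → ℕ) → Fin d → ℝ} {g : Fin k → (Fin d → ℝ) → ℝ} {Δ : ℕ}
  {p : Setting d k} {M : Measure ℝ} {G : Measure (Fin k → ℝ)} {L : Measure ℝ}
  {ψ : (ℕ → Fin k → ℝ) → ℝ≥0∞}

/-- The expectation of `ψ` of the outputs after `r` more time steps, if `σ` is the state after `n`
time steps. -/
noncomputable def value (o : List (Fin d → ℕ) → Fin d → ℝ) (g : Fin k → (Fin d → ℝ) → ℝ) (Δ : ℕ)
    (p : Setting d k) (M : Measure ℝ) (G : Measure (Fin k → ℝ)) (L : Measure ℝ)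
    (ψ : (ℕ → Fin k → ℝ) → ℝ≥0∞) (x₁ x₂ x₃ : ℕ → Fin d → Bool) :
    ℕ → ℕ → HybridState d k → ℝ≥0∞
  | _, 0, σ => ψ σ.hist
  | n, r + 1, σ => ∫⁻ z, value o g Δ p M G L ψ x₁ x₂ x₃ (n + 1) r
      (next o g Δ p n (x₁ n) (x₂ n) (x₃ n) z σ) ∂M.prod (G.prod L)

@[fun_prop]
theorem measurable_value [SFinite M] [SFinite G] [SFinite L] (hg : ∀ i, Measurable (g i))
    (hψ : Measurable ψ) (x₁ x₂ x₃ : ℕ → Fin d → Bool) (n r : ℕ) :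
    Measurable (value o g Δ p M G L ψ x₁ x₂ x₃ n r) := by
  induction r generalizing n with
  | zero => exact hψ.comp measurable_hist
  | succ r ih =>
    exact ((ih (n + 1)).comp (measurable_next (Θ := HybridState d k × Noise k) hg
      (o := fun _ => o) (fun _ => measurable_const) Δ p measurable_fst n _ _ _
      measurable_snd)).lintegral_prod_right'

theorem value_le_one [IsProbabilityMeasure M] [IsProbabilityMeasure G] [IsProbabilityMeasure L]
    (hψ1 : ∀ h, ψ h ≤ 1) (x₁ x₂ x₃ : ℕ → Fin d → Bool) (n r : ℕ) (σ : HybridState d k) :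
    value o g Δ p M G L ψ x₁ x₂ x₃ n r σ ≤ 1 := by
  induction r generalizing n σ with
  | zero => exact hψ1 _
  | succ r ih =>
    calc _ ≤ ∫⁻ _, 1 ∂M.prod (G.prod L) := lintegral_mono fun z => ih _ _
      _ = 1 := by simp

theorem value_congr {x₁ x₂ x₃ x₁' x₂' x₃' : ℕ → Fin d → Bool} {n : ℕ}
    (h : ∀ m, n ≤ m → x₁ m = x₁' m ∧ x₂ m = x₂' m ∧ x₃ m = x₃' m) (r : ℕ) :
    value o g Δ p M G L ψ x₁ x₂ x₃ n r = value o g Δ p M G L ψ x₁' x₂' x₃' n r := by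
  induction r generalizing n with
  | zero => rfl
  | succ r ih =>
    ext σ
    obtain ⟨h1, h2, h3⟩ := h n le_rfl
    simp only [value, h1, h2, h3, ih fun m (hm : n + 1 ≤ m) => h m (by omega)]

open Classical in
theorem value_succ [SFinite M] [IsProbabilityMeasure G] [IsProbabilityMeasure L]
    (hg : ∀ i, Measurable (g i)) (hψ : Measurable ψ) (x₁ x₂ x₃ : ℕ → Fin d → Bool) (n r : ℕ)
    (σ : HybridState d k) :
    value o g Δ p M G L ψ x₁ x₂ x₃ n (r + 1) σ = ∫⁻ mu,
      (if σ.Closes g Δ (x₁ n) mu then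
        ∫⁻ nu, ∫⁻ tau, value o g Δ p M G L ψ x₁ x₂ x₃ (n + 1) r
          (σ.close o g p n (x₂ n) (x₃ n) (nu, tau)) ∂L ∂G
      else value o g Δ p M G L ψ x₁ x₂ x₃ (n + 1) r (σ.carry n (x₁ n) (x₂ n) (x₃ n)))
      ∂M := by
  have h1 : Measurable fun z : Noise k => next o g Δ p n (x₁ n) (x₂ n) (x₃ n) z σ :=
    measurable_next hg (o := fun _ => o) (fun _ => measurable_const) Δ p
      measurable_const n _ _ _ measurable_id
  have h2 : Measurable fun z : (Fin k → ℝ) × ℝ => σ.close o g p n (x₂ n) (x₃ n) z :=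
    measurable_close hg (o := fun _ => o) (fun _ => measurable_const) p
      measurable_const n _ _ measurable_id
  have h3 := measurable_value (o := o) (Δ := Δ) (p := p) (M := M) (G := G) (L := L) hg hψ
    x₁ x₂ x₃ (n + 1) r
  rw [value]
  refine (lintegral_prod _ (h3.comp h1).aemeasurable).trans ?_
  refine lintegral_congr fun mu => ?_
  simp only [Function.comp_apply, next]
  split_ifs with hc
  · exact lintegral_prod _ (h3.comp h2).aemeasurable
  · simp

theorem run_update (x₁ x₂ x₃ : ℕ → Fin d → Bool) (tau : ℝ) (zs : Fin T → Noise k) (i : Fin T)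
    (z : Noise k) (n : ℕ) (hn : n ≤ i) :
    run o g Δ p x₁ x₂ x₃ tau (Function.update zs i z) n = run o g Δ p x₁ x₂ x₃ tau zs n := by
  induction n with
  | zero => rfl
  | succ n ih =>
    simp only [run]
    rw [ih (by omega)]
    split_ifs with h
    · rw [Function.update_of_ne]
      intro h'
      have := congrArg Fin.val h'
      simp at this
      omega
    · rfl

/-- Along the run, the expectation of `value` at the current state is the same at every time:
resampling the noise of step `n` turns `value` at time `n` into `value` at time `n + 1`, because the
state at time `n` does not depend on that noise. -/
theorem lintegral_run [IsProbabilityMeasure M] [IsProbabilityMeasure G]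
    [IsProbabilityMeasure L] (hg : ∀ i, Measurable (g i)) (hψ : Measurable ψ)
    (x₁ x₂ x₃ : ℕ → Fin d → Bool) (tau : ℝ) :
    ∫⁻ zs, ψ (run o g Δ p x₁ x₂ x₃ tau zs T).hist
        ∂(Measure.pi fun _ : Fin T => M.prod (G.prod L)) =
      value o g Δ p M G L ψ x₁ x₂ x₃ 0 T (init g p tau) := by
  have key : ∀ r n, n + r = T → ∫⁻ zs, value o g Δ p M G L ψ x₁ x₂ x₃ n r
      (run o g Δ p x₁ x₂ x₃ tau zs n) ∂(Measure.pi fun _ : Fin T => M.prod (G.prod L)) =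
      ∫⁻ zs, ψ (run o g Δ p x₁ x₂ x₃ tau zs T).hist
        ∂(Measure.pi fun _ : Fin T => M.prod (G.prod L)) := by
    intro r
    induction r with
    | zero => rintro n rfl; rfl
    | succ r ih =>
      intro n hn
      have hm : Measurable fun zs : Fin T → Noise k => run o g Δ p x₁ x₂ x₃ tau zs (n + 1) :=
        measurable_run hg (o := fun _ => o) (fun _ => measurable_const) Δ p _ _ _
          measurable_const measurable_id _
      have hn' : n < T := by omega
      have hv := measurable_value (o := o) (Δ := Δ) (p := p) (M := M) (G := G) (L := L) hg hψ
        x₁ x₂ x₃ (n + 1) r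
      rw [← ih (n + 1) (by omega)]
      refine Eq.trans ?_ (lintegral_pi_resample _ ⟨n, hn'⟩ (hv.comp hm)).symm
      refine lintegral_congr fun zs => ?_
      rw [value]
      refine lintegral_congr fun z => ?_
      rw [Function.comp_apply, run, dif_pos hn', run_update _ _ _ _ _ _ _ _ le_rfl,
        Function.update_self]
  rw [← key T 0 (by omega)]
  simp [run]

end Value

/-! ### Exchanging the stream in the threshold updates and in the closing test. -/

theorem toReal_rowNat_sub_le {d : ℕ} (u w : Fin d → Bool) (i : Fin d) :
    |toReal (rowNat u) i - toReal (rowNat w) i| ≤ 1 := by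
  simp only [toReal, rowNat]
  cases u i <;> cases w i <;> simp

section Compare

variable {d k T : ℕ} {o : List (Fin d → ℕ) → Fin d → ℝ} {g : Fin k → (Fin d → ℝ) → ℝ} {Δ : ℕ}
  {p : Setting d k} {M : Measure ℝ} {G : Measure (Fin k → ℝ)} {L : Measure ℝ}
  {ψ : (ℕ → Fin k → ℝ) → ℝ≥0∞} {E D : ℝ≥0∞} {tstar : ℕ}

/-- If `s` and `s'` are equal before the time step `tstar` and within distance `1` after it, then
so are they after adding rows that differ only at time `tstar`. -/
theorem add_row_close {x x' : ℕ → Fin d → Bool} (hx : ∀ n, n ≠ tstar → x n = x' n) {n : ℕ}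
    {s s' : Fin d → ℝ} (h1 : n ≤ tstar → s = s') (h2 : ∀ i, |s i - s' i| ≤ 1) :
    (n + 1 ≤ tstar → s + toReal (rowNat (x n)) = s' + toReal (rowNat (x' n))) ∧
      ∀ i, |(s + toReal (rowNat (x n))) i - (s' + toReal (rowNat (x' n))) i| ≤ 1 := by
  refine ⟨fun hn => by rw [h1 (by omega), hx n (by omega)], fun i => ?_⟩
  by_cases hn : n = tstar
  · rw [h1 hn.le]
    simpa using toReal_rowNat_sub_le (x n) (x' n) i
  · rw [hx n hn]
    simpa using h2 i

/-- Averaging over a probability measure leaves the additive error unchanged, so it does not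
accumulate over time steps. -/
theorem lintegral_le_mul_add {α : Type*} [MeasurableSpace α] {μ : Measure α}
    [IsProbabilityMeasure μ] (hE : E ≠ ∞) {f h : α → ℝ≥0∞} (hfh : ∀ x, f x ≤ E * h x + D) :
    ∫⁻ x, f x ∂μ ≤ E * ∫⁻ x, h x ∂μ + D := by
  calc _ ≤ ∫⁻ x, (E * h x + D) ∂μ := lintegral_mono hfh
    _ = _ := by rw [lintegral_add_right _ measurable_const, lintegral_const_mul' _ _ hE]; simp

open Classical in
theorem lintegral_closes (hg : ∀ i, Measurable (g i)) (σ : HybridState d k) (u : Fin d → Bool)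
    (a b : ℝ≥0∞) : ∫⁻ mu, (if Closes g Δ σ u mu then a else b) ∂M =
      a * M {mu | Closes g Δ σ u mu} + b * M {mu | Closes g Δ σ u mu}ᶜ := by
  have hm : MeasurableSet {mu | Closes g Δ σ u mu} :=
    measurableSet_closes hg Δ measurable_const u measurable_id
  have h1 : ∀ mu ∈ {mu | Closes g Δ σ u mu}, (if Closes g Δ σ u mu then a else b) = a :=
    fun mu h => if_pos h
  have h2 : ∀ mu ∈ {mu | Closes g Δ σ u mu}ᶜ, (if Closes g Δ σ u mu then a else b) = b :=
    fun mu h => if_neg h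
  rw [← lintegral_add_compl _ hm, setLIntegral_congr_fun hm h1, setLIntegral_congr_fun hm.compl h2]
  simp

variable [IsProbabilityMeasure M] [IsProbabilityMeasure G] [IsProbabilityMeasure L]

/-- `q` is read only when an interval is closed, and is then overwritten by the answer of the
oracle. So at most one closing sees different query values, the first one at or after `tstar`, and
`hG` is used once along every branch. -/
theorem value_le_of_update_stream (hg : ∀ i, Measurable (g i))
    (hsens : ∀ i (v w : Fin d → ℝ), (∀ j, |v j - w j| ≤ 1) → |g i v - g i w| ≤ 1)
    (hψ : Measurable ψ) (hψ1 : ∀ h, ψ h ≤ 1) (hE : 1 ≤ E)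
    (hE' : E ≠ ∞)
    (hG : ∀ a b : Fin k → ℝ, (∀ i, |a i - b i| ≤ 1) → ∀ f : (Fin k → ℝ) → ℝ≥0∞, Measurable f →
      (∀ y, f y ≤ 1) → ∫⁻ y, f (y + a) ∂G ≤ E * ∫⁻ y, f (y + b) ∂G + D)
    {x₁ x₂ x₂' x₃ : ℕ → Fin d → Bool} (hx : ∀ n, n ≠ tstar → x₂ n = x₂' n) (r n : ℕ)
    (σ : HybridState d k) (q' : Fin d → ℝ) (h1 : n ≤ tstar → σ.q = q')
    (h2 : ∀ i, |σ.q i - q' i| ≤ 1) :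
    value o g Δ p M G L ψ x₁ x₂ x₃ n r σ ≤
      E * value o g Δ p M G L ψ x₁ x₂' x₃ n r { σ with q := q' } + D := by
  have hle : ∀ a : ℝ≥0∞, a ≤ E * a + D := fun a =>
    (le_mul_of_one_le_left zero_le hE).trans le_self_add
  induction r generalizing n σ q' with
  | zero => exact hle _
  | succ r ih =>
    obtain ⟨h3, h4⟩ := add_row_close hx h1 h2
    rw [value_succ hg hψ, value_succ hg hψ]
    refine lintegral_le_mul_add hE' fun mu => ?_
    by_cases hc : Closes g Δ σ (x₁ n) mu
    · rw [if_pos hc, if_pos (show Closes g Δ { σ with q := q' } (x₁ n) mu from hc)]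
      by_cases hn : n + 1 ≤ tstar
      -- A closing before `tstar` produces the same state on both sides, so the induction continues
      -- with equal `q`.
      · refine lintegral_le_mul_add hE' fun nu => lintegral_le_mul_add hE' fun tau => ?_
        have hclose : close o g p { σ with q := q' } n (x₂' n) (x₃ n) (nu, tau) =
            close o g p σ n (x₂ n) (x₃ n) (nu, tau) := by
          simp only [close, ← h3 hn]
          rfl
        rw [hclose]
        exact ih (n + 1) _ (close o g p σ n (x₂ n) (x₃ n) (nu, tau)).q (fun _ => rfl)
          fun i => by simp
      -- From here on the streams agree, so both sides integrate the same function of the noisy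
      -- query values, under two shifts of the noise.
      · have hv : value o g Δ p M G L ψ x₁ x₂ x₃ (n + 1) r =
            value o g Δ p M G L ψ x₁ x₂' x₃ (n + 1) r :=
          value_congr (fun m hm => ⟨rfl, hx m (by omega), rfl⟩) r
        rw [hv]
        refine hG _ _ (fun i => hsens i _ _ h4)
          (fun y => ∫⁻ tau, value o g Δ p M G L ψ x₁ x₂' x₃ (n + 1) r
            (σ.reset o g p n (x₃ n) (y, tau)) ∂L) ?_ fun y => ?_
        · have := (measurable_value (o := o) (Δ := Δ) (p := p) (M := M) (G := G) (L := L) hg hψ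
            x₁ x₂' x₃ (n + 1) r).comp (measurable_reset (Θ := (Fin k → ℝ) × ℝ) (o := fun _ => o)
              hg (fun _ => measurable_const) p (measurable_const (a := σ)) n (x₃ n) measurable_id)
          exact this.lintegral_prod_right'
        · calc _ ≤ ∫⁻ _, 1 ∂L := lintegral_mono fun tau => value_le_one hψ1 _ _ _ _ _ _
            _ = 1 := by simp
    · rw [if_neg hc, if_neg (show ¬Closes g Δ { σ with q := q' } (x₁ n) mu from hc)]
      exact ih (n + 1) (σ.carry n (x₁ n) (x₂ n) (x₃ n)) (q' + toReal (rowNat (x₂' n))) h3 h4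

/-- The values `g i s` and `g i s'` differ by at most `1`. With `tau` raised by `1`, not closing for
`s` implies not closing for `s'` at the same `mu`, at no cost; closing for `s` implies closing for
`s'` once `mu` is raised by `2`. After closing the two states coincide, so the factor `E` is paid
only once, at the closing step. -/
theorem value_le_of_add_tau (hg : ∀ i, Measurable (g i))
    (hsens : ∀ i (v w : Fin d → ℝ), (∀ j, |v j - w j| ≤ 1) → |g i v - g i w| ≤ 1)
    (hψ : Measurable ψ) (hE : 1 ≤ E)
    (hM : ∀ A B : Set ℝ, MeasurableSet B → (∀ x ∈ A, x + 2 ∈ B) → M A ≤ E * M B)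
    {x₁ x₁' x₂ x₃ : ℕ → Fin d → Bool} (hx : ∀ n, n ≠ tstar → x₁ n = x₁' n) (r n : ℕ)
    (hn : tstar ≤ n) (σ : HybridState d k) (s' : Fin d → ℝ) (h1 : n ≤ tstar → σ.s = s')
    (h2 : ∀ i, |σ.s i - s' i| ≤ 1) :
    value o g Δ p M G L ψ x₁ x₂ x₃ n r σ ≤
      E * value o g Δ p M G L ψ x₁' x₂ x₃ n r { σ with s := s', tau := σ.tau + 1 } := by
  classical
  have hle : ∀ a : ℝ≥0∞, a ≤ E * a := fun a => le_mul_of_one_le_left zero_le hE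
  induction r generalizing n σ s' with
  | zero => exact hle _
  | succ r ih =>
    obtain ⟨h3, h4⟩ := add_row_close hx h1 h2
    rw [value_succ hg hψ, value_succ hg hψ]
    set σ' : HybridState d k := { σ with s := s', tau := σ.tau + 1 } with hσ'
    have hv : value o g Δ p M G L ψ x₁ x₂ x₃ (n + 1) r =
        value o g Δ p M G L ψ x₁' x₂ x₃ (n + 1) r :=
      value_congr (fun m hm => ⟨hx m (by omega), rfl, rfl⟩) r
    -- Closing overwrites both `s` and `tau`, the only fields in which the states differ.
    have hW : ∀ z, σ'.close o g p n (x₂ n) (x₃ n) z = σ.close o g p n (x₂ n) (x₃ n) z :=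
      fun z => rfl
    have hV := ih (n + 1) (by omega) (σ.carry n (x₁ n) (x₂ n) (x₃ n))
      (s' + toReal (rowNat (x₁' n))) h3 h4
    simp only [hW, ← hv]
    set W := ∫⁻ nu, ∫⁻ tau, value o g Δ p M G L ψ x₁ x₂ x₃ (n + 1) r
      (close o g p σ n (x₂ n) (x₃ n) (nu, tau)) ∂L ∂G
    set V := value o g Δ p M G L ψ x₁ x₂ x₃ (n + 1) r (σ.carry n (x₁ n) (x₂ n) (x₃ n))
    have hV' : V ≤ E * value o g Δ p M G L ψ x₁ x₂ x₃ (n + 1) r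
        (σ'.carry n (x₁' n) (x₂ n) (x₃ n)) := by rw [hv]; exact hV
    set V' := value o g Δ p M G L ψ x₁ x₂ x₃ (n + 1) r (σ'.carry n (x₁' n) (x₂ n) (x₃ n))
    have hm : ∀ (σ : HybridState d k) u, MeasurableSet {mu | Closes g Δ σ u mu} := fun σ u =>
      measurableSet_closes hg Δ measurable_const u measurable_id
    rw [lintegral_closes hg, lintegral_closes hg, mul_add]
    gcongr ?_ + ?_
    · rw [mul_left_comm]
      gcongr
      refine hM _ _ (hm _ _) fun mu hmu => ⟨?_, hmu.2⟩
      obtain ⟨⟨i, hi⟩, -⟩ := hmu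
      refine ⟨i, ?_⟩
      have := abs_le.1 (hsens i _ _ h4)
      simp only [hσ']
      linarith
    · rw [← mul_assoc]
      gcongr
      intro hc
      obtain ⟨⟨i, hi⟩, hlen⟩ := hc
      refine ⟨⟨i, ?_⟩, hlen⟩
      have := abs_le.1 (hsens i _ _ h4)
      simp only [hσ'] at hi
      linarith

/-- `A` collects the values of `tau` for which the current interval has stayed open so far, given
the earlier `mu`. It is an upper set, hence mapped into itself by `tau ↦ tau + 1`, and therefore the
shift of `tau` may be postponed until time `tstar`. One factor `E` pays for `tau`, the other for
`mu`. -/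
theorem setLIntegral_value_le (hg : ∀ i, Measurable (g i))
    (hsens : ∀ i (v w : Fin d → ℝ), (∀ j, |v j - w j| ≤ 1) → |g i v - g i w| ≤ 1)
    (hψ : Measurable ψ) (hE : 1 ≤ E) (hE' : E ≠ ∞)
    (hM : ∀ A B : Set ℝ, MeasurableSet B → (∀ x ∈ A, x + 2 ∈ B) → M A ≤ E * M B)
    (hL : ∀ f : ℝ → ℝ≥0∞, Measurable f → ∫⁻ x, f (x + 1) ∂L ≤ E * ∫⁻ x, f x ∂L)
    {x₁ x₁' x₂ x₃ : ℕ → Fin d → Bool} (hx : ∀ n, n ≠ tstar → x₁ n = x₁' n) (r n : ℕ)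
    (hn : n ≤ tstar) (σ : HybridState d k) (A : Set ℝ) (hA : MeasurableSet A)
    (hA' : IsUpperSet A) :
    ∫⁻ tau in A, value o g Δ p M G L ψ x₁ x₂ x₃ n r { σ with tau := tau } ∂L ≤
      E * E * ∫⁻ tau in A, value o g Δ p M G L ψ x₁' x₂ x₃ n r { σ with tau := tau } ∂L := by
  classical
  have hle : ∀ a : ℝ≥0∞, a ≤ E * E * a := fun a =>
    le_mul_of_one_le_left zero_le (one_le_mul hE hE)
  have hm : ∀ (x₁ : ℕ → Fin d → Bool) n r (σ : HybridState d k), Measurable fun tau : ℝ =>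
      value o g Δ p M G L ψ x₁ x₂ x₃ n r { σ with tau := tau } := fun x₁ n r σ =>
    (measurable_value hg hψ x₁ x₂ x₃ n r).comp (by fun_prop)
  induction r generalizing n σ A with
  | zero => exact hle _
  | succ r ih =>
    rcases hn.lt_or_eq with hn | rfl
    · set W : (ℕ → Fin d → Bool) → ℝ≥0∞ := fun x₁ => ∫⁻ nu, ∫⁻ tau,
        value o g Δ p M G L ψ x₁ x₂ x₃ (n + 1) r (σ.close o g p n (x₂ n) (x₃ n) (nu, tau)) ∂L ∂G
        with hWdef
      have hEE : E * E ≠ ∞ := ENNReal.mul_ne_top hE' hE'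
      have hW : W x₁ ≤ E * E * W x₁' := by
        simp only [hWdef]
        rw [← lintegral_const_mul' _ _ hEE]
        refine lintegral_mono fun nu => ?_
        -- The value `0` is a dummy: the induction hypothesis replaces it by the fresh `tau`, which
        -- is unrestricted in a new interval.
        have := ih (n + 1) hn (σ.close o g p n (x₂ n) (x₃ n) (nu, 0)) Set.univ MeasurableSet.univ
          isUpperSet_univ
        rw [Measure.restrict_univ] at this
        exact this
      let C : ℝ → Set ℝ := fun mu => {tau | Closes g Δ { σ with tau := tau } (x₁ n) mu}
      have hC : ∀ mu, MeasurableSet (C mu) := fun mu =>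
        measurableSet_closes hg Δ (σ := fun tau => { σ with tau := tau }) (by fun_prop) _
          measurable_const
      have hvalue : ∀ y : ℕ → Fin d → Bool, y n = x₁ n →
          ∫⁻ tau in A, value o g Δ p M G L ψ y x₂ x₃ n (r + 1) { σ with tau := tau } ∂L =
          ∫⁻ mu, (W y * L.restrict A (C mu) + ∫⁻ tau in A ∩ (C mu)ᶜ,
            value o g Δ p M G L ψ y x₂ x₃ (n + 1) r
              { σ.carry n (x₁ n) (x₂ n) (x₃ n) with tau := tau } ∂L) ∂M := by
        intro y hy
        simp_rw [value_succ hg hψ, hy]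
        -- With `mu` fixed first, the event that the interval stays open becomes a condition on
        -- `tau` alone, and can be absorbed into `A`.
        rw [lintegral_lintegral_swap]
        · refine lintegral_congr fun mu => ?_
          rw [← lintegral_add_compl _ (hC mu)]
          congr 1
          · have h1 : ∀ tau ∈ C mu, (if Closes g Δ { σ with tau := tau } (x₁ n) mu then W y else
                value o g Δ p M G L ψ y x₂ x₃ (n + 1) r
                  { σ.carry n (x₁ n) (x₂ n) (x₃ n) with tau := tau }) = W y :=
              fun tau h => if_pos h
            exact (setLIntegral_congr_fun (hC mu) h1).trans (setLIntegral_const _ _)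
          · have h2 : ∀ tau ∈ (C mu)ᶜ, (if Closes g Δ { σ with tau := tau } (x₁ n) mu then W y else
                value o g Δ p M G L ψ y x₂ x₃ (n + 1) r
                  { σ.carry n (x₁ n) (x₂ n) (x₃ n) with tau := tau }) =
                value o g Δ p M G L ψ y x₂ x₃ (n + 1) r
                  { σ.carry n (x₁ n) (x₂ n) (x₃ n) with tau := tau } := fun tau h => if_neg h
            rw [Set.inter_comm, ← Measure.restrict_restrict (hC mu).compl]
            exact setLIntegral_congr_fun (hC mu).compl h2
        · have hCm := measurableSet_closes (Θ := ℝ × ℝ) hg Δ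
            (σ := fun q => { σ with tau := q.1 }) (by fun_prop) (x₁ n) measurable_snd
          exact (Measurable.ite hCm (measurable_const (a := W y))
            ((hm y (n + 1) r (σ.carry n (x₁ n) (x₂ n) (x₃ n))).comp measurable_fst)).aemeasurable
      rw [hvalue x₁ rfl, hvalue x₁' (hx n hn.ne).symm, ← lintegral_const_mul' _ _ hEE]
      refine lintegral_mono fun mu => ?_
      rw [mul_add, ← mul_assoc]
      gcongr
      refine ih (n + 1) hn _ _ (hA.inter (hC mu).compl) (hA'.inter ?_)
      -- A larger `tau` closes less often, so staying open is an upper set in `tau`.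
      intro a b hab ha hb
      refine ha ⟨?_, hb.2⟩
      obtain ⟨i, hi⟩ := hb.1
      refine ⟨i, ?_⟩
      simp only at hi ⊢
      linarith
    · set h : ℝ → ℝ≥0∞ := fun tau =>
        value o g Δ p M G L ψ x₁' x₂ x₃ n (r + 1) { σ with tau := tau } with hdef
      have hh : Measurable h := hm _ _ _ _
      calc _ ≤ ∫⁻ tau in A, E * h (tau + 1) ∂L := lintegral_mono fun tau =>
            value_le_of_add_tau hg hsens hψ hE hM hx (r + 1) n le_rfl { σ with tau := tau } σ.s
              (fun _ => rfl) (by simp)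
        _ = E * ∫⁻ tau in A, h (tau + 1) ∂L := lintegral_const_mul' _ _ hE'
        _ ≤ E * ∫⁻ tau, A.indicator h (tau + 1) ∂L := by
          gcongr E * ?_
          rw [← lintegral_indicator hA]
          refine lintegral_mono fun tau => Set.indicator_apply_le' (fun ht => ?_) fun _ => zero_le
          rw [Set.indicator_of_mem (hA' (by linarith) ht)]
        _ ≤ E * (E * ∫⁻ tau, A.indicator h tau ∂L) := by
          gcongr
          exact hL _ (hh.indicator hA)
        _ = _ := by rw [lintegral_indicator hA, mul_assoc]

end Compare

/-! ### The privacy game -/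

section Play

variable {d N : ℕ} {Ω Ω' : Type*} [MeasurableSpace Ω] [MeasurableSpace Ω']
  (M : HistogramMechanism d Ω) (A : Adversary d N Ω') (side : Side) (ω : Ω) (ω' : Ω')

theorem length_play (n : ℕ) : (play M A side ω ω' n).1.length = n := by
  induction n with
  | zero => rfl
  | succ n ih => simp [play, ih]

theorem play_prefix {n m : ℕ} (h : n ≤ m) :
    (play M A side ω ω' n).1 <+: (play M A side ω ω' m).1 ∧
      ∀ i : Fin n, (play M A side ω ω' m).2 (Fin.castLE h i) = (play M A side ω ω' n).2 i := by
  induction m, h using Nat.le_induction with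
  | base => exact ⟨List.prefix_rfl, fun i => rfl⟩
  | succ m hm ih =>
    refine ⟨ih.1.trans (List.prefix_append _ _), fun i => ?_⟩
    rw [← ih.2 i]
    exact Fin.snoc_castSucc (α := fun _ => Fin d → ℝ) _ _ (Fin.castLE hm i)

theorem firstEntries_play (n : Fin N) :
    firstEntries (play M A side ω ω' N).2 n = (play M A side ω ω' n).2 :=
  funext fun i => (play_prefix M A side ω ω' n.2.le).2 i

theorem getD_play (n : Fin N) :
    (play M A side ω ω' N).1.getD n 0 =
      (A.move n ω' (firstEntries (play M A side ω ω' N).2 n)).sent side := by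
  rw [firstEntries_play]
  obtain ⟨l, hl⟩ := (play_prefix M A side ω ω' (Nat.succ_le_of_lt n.2)).1
  rw [← hl, List.getD_append _ _ _ _ (by rw [length_play]; omega)]
  simp only [play]
  rw [List.getD_append_right _ _ _ _ (by rw [length_play]), length_play]
  simp

theorem answer_play (n : Fin N) :
    (play M A side ω ω' N).2 n = M.out ω ((play M A side ω ω' N).1.take (n + 1)) := by
  obtain ⟨⟨l, hl⟩, h2⟩ := play_prefix M A side ω ω' (Nat.succ_le_of_lt n.2)
  rw [← hl, List.take_append_of_le_length (by rw [length_play]),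
    List.take_of_length_le (by rw [length_play])]
  refine (h2 (Fin.last n)).trans ?_
  simp only [play]
  exact Fin.snoc_last (α := fun _ => Fin d → ℝ) _ _

end Play

/-! ### Runs with given answers -/

section Runs

variable {d k T : ℕ} {g : Fin k → (Fin d → ℝ) → ℝ} {Δ : ℕ} {p : Setting d k}
  {o o' : List (Fin d → ℕ) → Fin d → ℝ} {x₁ x₂ x₃ x₃' : ℕ → Fin d → Bool} {tau : ℝ}
  {zs : Fin T → Noise k}

theorem ins_next (n : ℕ) (u₁ u₂ u₃ : Fin d → Bool) (z : Noise k) (σ : HybridState d k) :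
    σ.ins <+: (next o g Δ p n u₁ u₂ u₃ z σ).ins := by
  unfold next
  split_ifs
  · exact List.prefix_append _ _
  · exact List.prefix_rfl

theorem ins_run_prefix {n m : ℕ} (h : n ≤ m) :
    (run o g Δ p x₁ x₂ x₃ tau zs n).ins <+: (run o g Δ p x₁ x₂ x₃ tau zs m).ins := by
  induction m, h using Nat.le_induction with
  | base => exact List.prefix_rfl
  | succ m _ ih =>
    refine ih.trans ?_
    conv_rhs => rw [run]
    split_ifs
    · exact ins_next _ _ _ _ _ _
    · exact List.prefix_rfl

theorem length_ins_run_le (n : ℕ) : (run o g Δ p x₁ x₂ x₃ tau zs n).ins.length ≤ Δ := by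
  induction n with
  | zero => simp [run, init]
  | succ n ih =>
    rw [run]
    split_ifs
    · unfold next
      split_ifs with hc
      · have := hc.2
        simp only [close, reset, List.length_append, List.length_singleton]
        omega
      · exact ih
    · exact ih

theorem run_congr {n : ℕ} (h : ∀ m < n, x₃ m = x₃' m) :
    run o g Δ p x₁ x₂ x₃ tau zs n = run o g Δ p x₁ x₂ x₃' tau zs n := by
  induction n with
  | zero => rfl
  | succ n ih => rw [run, run, ih fun m hm => h m (by omega), h n (by omega)]

/-- The insertions up to the `n`-th one depend only on the first `n` answers. -/
theorem run_causal {n : ℕ} (ho : ∀ l : List (Fin d → ℕ), 0 < l.length → l.length ≤ n → o l = o' l)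
    (m : ℕ) :
    run o g Δ p x₁ x₂ x₃ tau zs m = run o' g Δ p x₁ x₂ x₃ tau zs m ∨
      n < (run o g Δ p x₁ x₂ x₃ tau zs m).ins.length ∧
      n < (run o' g Δ p x₁ x₂ x₃ tau zs m).ins.length ∧
      (run o g Δ p x₁ x₂ x₃ tau zs m).ins.take (n + 1) =
        (run o' g Δ p x₁ x₂ x₃ tau zs m).ins.take (n + 1) := by
  induction m with
  | zero => exact Or.inl rfl
  | succ m ih =>
    rw [run, run]
    split_ifs with hm
    · rcases ih with h | ⟨h1, h2, h3⟩
      · rw [h]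
        generalize run o' g Δ p x₁ x₂ x₃ tau zs m = σ
        unfold next
        split_ifs
        · by_cases hl : σ.ins.length < n
          · left
            simp only [close, reset]
            rw [ho _ (by simp) (by simp; omega)]
          -- The oracles may disagree on the answer to this insertion, but it is insertion number `n
          -- + 1` and was itself chosen in a common state.
          · right
            simp only [close, reset, List.length_append, List.length_singleton, and_true]
            omega
        · exact Or.inl rfl
      · right
        obtain ⟨l, hl⟩ := ins_next (o := o) (g := g) (Δ := Δ) (p := p) m (x₁ m) (x₂ m) (x₃ m)
          (zs ⟨m, hm⟩) (run o g Δ p x₁ x₂ x₃ tau zs m)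
        obtain ⟨l', hl'⟩ := ins_next (o := o') (g := g) (Δ := Δ) (p := p) m (x₁ m) (x₂ m) (x₃ m)
          (zs ⟨m, hm⟩) (run o' g Δ p x₁ x₂ x₃ tau zs m)
        rw [← hl, ← hl', List.take_append_of_le_length h1, List.take_append_of_le_length h2]
        simp only [List.length_append]
        exact ⟨by omega, by omega, h3⟩
    · exact ih

theorem getD_eq_of_take_eq {α : Type*} {l l' : List α} {n : ℕ}
    (h : l.take (n + 1) = l'.take (n + 1)) (a : α) : l.getD n a = l'.getD n a := by
  have := congrArg (fun l => l.getD n a) h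
  simpa [List.getD_eq_getElem?_getD] using this

theorem getD_run_causal {n : ℕ}
    (ho : ∀ l : List (Fin d → ℕ), 0 < l.length → l.length ≤ n → o l = o' l) (m : ℕ) :
    (run o g Δ p x₁ x₂ x₃ tau zs m).ins.getD n 0 =
      (run o' g Δ p x₁ x₂ x₃ tau zs m).ins.getD n 0 := by
  rcases run_causal (g := g) (Δ := Δ) (p := p) (x₁ := x₁) (x₂ := x₂) (x₃ := x₃) (tau := tau)
    (zs := zs) ho m with h | ⟨-, -, h⟩
  · rw [h]
  · exact getD_eq_of_take_eq h 0

/-- The states of two runs that differ only in the inputs of the histogram mechanism, at most in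
the one with index `J`, and there by at most `1`. -/
structure Adjacent (J : ℕ) (σ σ' : HybridState d k) : Prop where
  eq : σ' = { σ with ins := σ'.ins, c := σ'.c }
  length : σ'.ins.length = σ.ins.length
  entry : ∀ i j, |(σ.ins.getD i 0 j : ℤ) - (σ'.ins.getD i 0 j : ℤ)| ≤ 1
  entry_eq : ∀ i, i ≠ J → σ.ins.getD i 0 = σ'.ins.getD i 0
  c : ∀ j, |(σ.c j : ℤ) - (σ'.c j : ℤ)| ≤ 1
  c_eq : σ.ins.length ≠ J → σ.c = σ'.c

theorem Adjacent.refl (J : ℕ) (σ : HybridState d k) : Adjacent J σ σ :=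
  ⟨rfl, rfl, by simp, fun _ _ => rfl, by simp, fun _ => rfl⟩

theorem rowNat_sub_le (u w : Fin d → Bool) (j : Fin d) :
    |(rowNat u j : ℤ) - (rowNat w j : ℤ)| ≤ 1 := by
  simp only [rowNat]
  cases u j <;> cases w j <;> simp

/-- When answers depend only on the number of inputs, the inserted vectors influence neither the
test nor the thresholds, so both runs close at the same times. The differing row stays in `c` until
it is inserted as entry `J`, and then `c` is reset. By `hu`, a differing row is allowed only while
the `c` still agree and exactly `J` insertions have been made. -/
theorem Adjacent.next (ho : ∀ l l' : List (Fin d → ℕ), l.length = l'.length → o l = o l') {J : ℕ}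
    {σ σ' : HybridState d k} (h : Adjacent J σ σ') (n : ℕ) (u₁ u₂ : Fin d → Bool)
    {u₃ u₃' : Fin d → Bool} (hu : u₃ = u₃' ∨ σ.c = σ'.c ∧ σ.ins.length = J) (z : Noise k) :
    Adjacent J (HybridState.next o g Δ p n u₁ u₂ u₃ z σ)
      (HybridState.next o g Δ p n u₁ u₂ u₃' z σ') := by
  obtain ⟨h1, h2, h3, h4, h5, h6⟩ := h
  have hc : ∀ j, |((σ.c + rowNat u₃) j : ℤ) - ((σ'.c + rowNat u₃') j : ℤ)| ≤ 1 := by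
    intro j
    rcases hu with rfl | ⟨hu, -⟩
    · simpa using h5 j
    · simpa [hu] using rowNat_sub_le u₃ u₃' j
  have hc' : σ.ins.length ≠ J → σ.c + rowNat u₃ = σ'.c + rowNat u₃' := by
    intro hJ
    rcases hu with rfl | ⟨-, hu⟩
    · rw [h6 hJ]
    · exact absurd hu hJ
  obtain ⟨ins', c', s', q', thr', tau', out', hist'⟩ := σ'
  simp only [HybridState.mk.injEq, true_and] at h1
  obtain ⟨rfl, rfl, rfl, rfl, rfl, rfl⟩ := h1
  simp only at h2 h3 h4 hc hc'
  have hgetD : ∀ (l : List (Fin d → ℕ)) (v : Fin d → ℕ) i, (l ++ [v]).getD i 0 =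
      if i < l.length then l.getD i 0 else if i = l.length then v else 0 := by
    intro l v i
    split_ifs with hi hi'
    · exact List.getD_append _ _ _ _ hi
    · subst hi'; simp
    · rw [List.getD_eq_default]
      simp only [List.length_append, List.length_singleton]
      omega
  unfold HybridState.next
  have hiff : Closes g Δ ⟨ins', c', σ.s, σ.q, σ.thr, σ.tau, σ.out, σ.hist⟩ u₁ z.1 ↔
      Closes g Δ σ u₁ z.1 := by simp only [Closes, h2]
  by_cases hcl : Closes g Δ σ u₁ z.1
  · rw [if_pos hcl, if_pos (hiff.2 hcl)]
    have ho' : o (σ.ins ++ [σ.c + rowNat u₃]) = o (ins' ++ [c' + rowNat u₃']) :=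
      ho _ _ (by simp [h2])
    refine ⟨?_, ?_, ?_, ?_, ?_, ?_⟩
    · simp only [close, reset, ho']
    · simp [close, reset, h2]
    · intro i j
      simp only [close, reset, hgetD, h2]
      split_ifs
      · exact h3 i j
      · exact hc j
      · simp
    · intro i hi
      simp only [close, reset, hgetD, h2]
      split_ifs with hi1 hi2
      · exact h4 i hi
      · exact hc' (by omega)
      · rfl
    · intro j; simp [close, reset]
    · intro _; rfl
  · rw [if_neg hcl, if_neg (hiff.not.2 hcl)]
    exact ⟨rfl, h2, h3, h4, hc, hc'⟩

theorem adjacent_run (ho : ∀ l l' : List (Fin d → ℕ), l.length = l'.length → o l = o l') {tstar : ℕ}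
    (hx : ∀ n, n ≠ tstar → x₃ n = x₃' n) (n : ℕ) :
    Adjacent (run o g Δ p x₁ x₂ x₃ tau zs tstar).ins.length (run o g Δ p x₁ x₂ x₃ tau zs n)
      (run o g Δ p x₁ x₂ x₃' tau zs n) := by
  rcases le_total n tstar with h | h
  · rw [run_congr (n := n) (x₃' := x₃') fun m hm => hx m (by omega)]
    exact Adjacent.refl _ _
  induction n, h using Nat.le_induction with
  | base =>
    rw [run_congr (n := tstar) fun m hm => hx m (by omega)]
    exact Adjacent.refl _ _
  | succ n hn ih =>
    conv => arg 2; rw [run]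
    conv => arg 3; rw [run]
    split_ifs
    · refine ih.next ho _ _ _ ?_ _
      by_cases hn' : n = tstar
      · subst hn'
        right
        rw [run_congr (x₃' := x₃') (n := n) fun m hm => hx m (by omega)]
        exact ⟨rfl, rfl⟩
      · exact Or.inl (hx n hn')
    · exact ih

end Runs

/-! ### The adversary that simulates the mechanism -/

/-- The answers `a`, by the number of inputs; missing answers are `0`. -/
def answers {d n : ℕ} (a : Fin n → Fin d → ℝ) (l : List (Fin d → ℕ)) : Fin d → ℝ :=
  if h : l.length - 1 < n then a ⟨l.length - 1, h⟩ else 0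

theorem answers_congr {d n : ℕ} (a : Fin n → Fin d → ℝ) (l l' : List (Fin d → ℕ))
    (h : l.length = l'.length) : answers a l = answers a l' := by
  simp only [answers, h]

theorem answers_firstEntries {d N : ℕ} (a : Fin N → Fin d → ℝ) (n : Fin N)
    (l : List (Fin d → ℕ)) (h0 : 0 < l.length) (h : l.length ≤ n) :
    answers (firstEntries a n) l = answers a l := by
  have := n.2
  rw [answers, answers, dif_pos (by omega), dif_pos (by omega)]
  rfl

theorem measurable_answers {d n : ℕ} (l : List (Fin d → ℕ)) :
    Measurable fun a : Fin n → Fin d → ℝ => answers a l := by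
  unfold answers
  split_ifs with h <;> fun_prop

section Adversary

variable {d k T N : ℕ} (g : Fin k → (Fin d → ℝ) → ℝ) (p : Setting d k)
  (x x' : ℕ → Fin d → Bool) (tstar : ℕ)

/-- The run of the mechanism with given answers. -/
noncomputable def simulate (N : ℕ) (y : ℕ → Fin d → Bool) {n : ℕ} (r : ℝ × (Fin T → Noise k))
    (a : Fin n → Fin d → ℝ) (m : ℕ) : HybridState d k :=
  run (answers a) g N p x x y r.1 r.2 m

/-- The index of the challenge. -/
noncomputable def challengeIndex (N : ℕ) {n : ℕ} (r : ℝ × (Fin T → Noise k))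
    (a : Fin n → Fin d → ℝ) : ℕ :=
  -- The number of insertions before `tstar` is the index of the one that would cover the differing
  -- row. If all `N` are already used up, no insertion covers it, and the last round serves as a
  -- challenge with two equal inputs.
  min (simulate g p x N x r a tstar).ins.length (N - 1)

/-- The move of the simulating adversary after `n` rounds. -/
noncomputable def simulatorMove (N : ℕ) (n : ℕ) (r : ℝ × (Fin T → Noise k))
    (a : Fin n → Fin d → ℝ) : Move d :=
  -- The run is simulated to time `T` with zeros for answers not yet given; by causality insertion
  -- `n` does not depend on those. Rounds beyond the last insertion are filled with the input `0`.
  if challengeIndex g p x tstar N r a = n then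
    Move.challenge ((simulate g p x N x r a T).ins.getD n 0)
      ((simulate g p x N x' r a T).ins.getD n 0)
  else Move.regular ((simulate g p x N x r a T).ins.getD n 0)

variable {g p x x' tstar}

theorem measurable_simulate (hg : ∀ i, Measurable (g i)) (y : ℕ → Fin d → Bool) (n m : ℕ) :
    Measurable fun q : (ℝ × (Fin T → Noise k)) × (Fin n → Fin d → ℝ) =>
      simulate g p x N y q.1 q.2 m :=
  measurable_run hg (fun l => (measurable_answers l).comp measurable_snd) N p x x y
    measurable_fst.fst measurable_fst.snd m

/-- With only the first `n` answers the index itself may come out differently, but then both runs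
have made more than `n` insertions, and whether it equals `n` is still decided correctly. -/
theorem challengeIndex_firstEntries (r : ℝ × (Fin T → Noise k)) (a : Fin N → Fin d → ℝ)
    (n : Fin N) : challengeIndex g p x tstar N r (firstEntries a n) = n ↔
      challengeIndex g p x tstar N r a = n := by
  unfold challengeIndex simulate
  rcases run_causal (g := g) (Δ := N) (p := p) (x₁ := x) (x₂ := x) (x₃ := x) (tau := r.1)
    (zs := r.2) (answers_firstEntries a n) tstar with h | ⟨h1, h2, -⟩
  · rw [h]
  · omega

theorem simulate_firstEntries (y : ℕ → Fin d → Bool) (r : ℝ × (Fin T → Noise k))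
    (a : Fin N → Fin d → ℝ) (n : Fin N) (m : ℕ) :
    (simulate g p x N y r (firstEntries a n) m).ins.getD n 0 =
      (simulate g p x N y r a m).ins.getD n 0 :=
  getD_run_causal (answers_firstEntries a n) m

theorem adjacent_simulate (hx : ∀ n, n ≠ tstar → x n = x' n) {n : ℕ} (r : ℝ × (Fin T → Noise k))
    (a : Fin n → Fin d → ℝ) (m : ℕ) :
    Adjacent (simulate g p x N x r a tstar).ins.length (simulate g p x N x r a m)
      (simulate g p x N x' r a m) :=
  adjacent_run (answers_congr a) hx m

theorem isChallenge_simulatorMove {n : ℕ} (r : ℝ × (Fin T → Noise k)) (a : Fin n → Fin d → ℝ) :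
    (simulatorMove g p x x' tstar N n r a).IsChallenge ↔
      challengeIndex g p x tstar N r a = n := by
  unfold simulatorMove
  split_ifs with h <;> simp [Move.IsChallenge, h]

/-- The adversary that simulates the mechanism, and plays the inputs for the two streams. -/
noncomputable def simulator (hg : ∀ i, Measurable (g i)) (hN : 0 < N)
    (hx : ∀ n, n ≠ tstar → x n = x' n) (P : Measure (ℝ × (Fin T → Noise k)))
    (hP : IsProbabilityMeasure P) : Adversary d N (ℝ × (Fin T → Noise k)) where
  law := P
  isProbabilityMeasure_law := hP
  move := simulatorMove g p x x' tstar N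
  measurable_move n := by
    let F : ℕ × List (Fin d → ℕ) × List (Fin d → ℕ) → Move d := fun q =>
      if min q.1 (N - 1) = n then Move.challenge (q.2.1.getD n 0) (q.2.2.getD n 0)
      else Move.regular (q.2.1.getD n 0)
    have hF : Measurable F := measurable_of_countable _
    have hlen : Measurable (List.length : List (Fin d → ℕ) → ℕ) := measurable_of_countable _
    exact hF.comp ((hlen.comp (measurable_ins.comp (measurable_simulate hg x n tstar))).prodMk
      ((measurable_ins.comp (measurable_simulate hg x n T)).prodMk
        (measurable_ins.comp (measurable_simulate hg x' n T))))
  valid_move n r a := by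
    unfold simulatorMove
    split_ifs
    · exact fun i => (adjacent_simulate hx r a T).entry n i
    · trivial
  existsUnique_challenge r a := by
    have hlt : challengeIndex g p x tstar N r a < N := by unfold challengeIndex; omega
    refine ⟨⟨_, hlt⟩, ?_, fun n hn => ?_⟩
    · exact (isChallenge_simulatorMove _ _).2 ((challengeIndex_firstEntries r a ⟨_, hlt⟩).2 rfl)
    · exact Fin.ext ((challengeIndex_firstEntries r a n).1
        ((isChallenge_simulatorMove _ _).1 hn)).symm

/-- The stream that is played on a side. -/
def sideStream (x x' : ℕ → Fin d → Bool) : Side → ℕ → Fin d → Bool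
  | Side.L => x
  | Side.R => x'

theorem sent_simulatorMove (hx : ∀ n, n ≠ tstar → x n = x' n) (side : Side)
    (r : ℝ × (Fin T → Noise k)) (a : Fin N → Fin d → ℝ) (n : Fin N) :
    (simulatorMove g p x x' tstar N n r (firstEntries a n)).sent side =
      (simulate g p x N (sideStream x x' side) r a T).ins.getD n 0 := by
  unfold simulatorMove
  simp only [challengeIndex_firstEntries, simulate_firstEntries]
  split_ifs with h
  · cases side <;> rfl
  · cases side
    · rfl
    · refine (adjacent_simulate hx r a T).entry_eq n fun hn => h ?_
      have := n.2
      unfold challengeIndex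
      omega

variable {Ω : Type*} [MeasurableSpace Ω] (H : HistogramMechanism d Ω)

/-- The inputs played in the game depend on the answers and the answers on the inputs. The loop is
resolved by induction on time: the simulated insertions are an initial segment of what `H` received
(`htake`), so each recorded answer is the answer of `H` to the simulated list. -/
theorem run_eq_simulate (hg : ∀ i, Measurable (g i)) (hN : 0 < N)
    (hx : ∀ n, n ≠ tstar → x n = x' n) (P : Measure (ℝ × (Fin T → Noise k)))
    (hP : IsProbabilityMeasure P) (side : Side) (ω : Ω) (r : ℝ × (Fin T → Noise k)) (m : ℕ) :
    run (H.out ω) g N p x x (sideStream x x' side) r.1 r.2 m =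
      simulate g p x N (sideStream x x' side) r
        (play H (simulator (p := p) hg hN hx P hP) side ω r N).2 m := by
  set A := simulator (p := p) hg hN hx P hP with hA
  set y := sideStream x x' side with hy
  set a := (play H A side ω r N).2 with ha
  set inputs := (play H A side ω r N).1 with hinputs
  have hget : ∀ n : Fin N, inputs.getD n 0 = (simulate g p x N y r a T).ins.getD n 0 := fun n =>
    (getD_play H A side ω r n).trans (sent_simulatorMove hx side r a n)
  have hans : ∀ n : Fin N, a n = H.out ω (inputs.take (n + 1)) := answer_play H A side ω r
  have hlen : inputs.length = N := length_play H A side ω r N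
  have htake : ∀ m ≤ T, (simulate g p x N y r a m).ins =
      inputs.take (simulate g p x N y r a m).ins.length := by
    intro m hm
    have hle : (simulate g p x N y r a m).ins.length ≤ N := length_ins_run_le m
    obtain ⟨l, hl⟩ : (simulate g p x N y r a m).ins <+: (simulate g p x N y r a T).ins :=
      ins_run_prefix hm
    refine List.ext_getElem (by rw [List.length_take, hlen]; omega) fun i h1 h2 => ?_
    have h3 := hget ⟨i, by omega⟩
    simp only [← hl] at h3
    rw [List.getD_append _ _ _ _ h1, List.getD_eq_getElem _ _ h1,
      List.getD_eq_getElem _ _ (by omega)] at h3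
    rw [List.getElem_take]
    exact h3.symm
  induction m with
  | zero => rfl
  | succ m ih =>
    by_cases hm : m < T
    · have h1 : simulate g p x N y r a (m + 1) = next (answers a) g N p m (x m) (x m) (y m)
          (r.2 ⟨m, hm⟩) (simulate g p x N y r a m) := by
        simp only [simulate]; rw [run, dif_pos hm]
      have h2 := htake (m + 1) hm
      have h4 : (simulate g p x N y r a (m + 1)).ins.length ≤ N := length_ins_run_le _
      rw [run, dif_pos hm, ih, h1]
      rw [h1] at h2 h4
      unfold next at h2 h4 ⊢
      split_ifs at h2 h4 ⊢
      · have h3 : H.out ω ((simulate g p x N y r a m).ins ++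
              [(simulate g p x N y r a m).c + rowNat (y m)]) =
            answers a ((simulate g p x N y r a m).ins ++
              [(simulate g p x N y r a m).c + rowNat (y m)]) := by
          simp only [close, reset] at h2 h4
          generalize hl : (simulate g p x N y r a m).ins ++
              [(simulate g p x N y r a m).c + rowNat (y m)] = l at h2 h4
          have hpos : l.length - 1 + 1 = l.length := by simp [← hl]
          rw [answers, dif_pos (by omega), hans, hpos, ← h2]
        simp only [close, reset, h3]
      · rfl
    · simp only [simulate] at ih ⊢
      rw [run, dif_neg hm, run, dif_neg hm, ih]

theorem hist_simulate_side (hx : ∀ n, n ≠ tstar → x n = x' n) (side : Side)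
    (r : ℝ × (Fin T → Noise k)) (a : Fin N → Fin d → ℝ) (m : ℕ) :
    (simulate g p x N (sideStream x x' side) r a m).hist = (simulate g p x N x r a m).hist := by
  cases side
  · rfl
  · have := (adjacent_simulate (g := g) (p := p) (N := N) hx r a m).eq
    have h := congrArg HybridState.hist this
    exact h

theorem measure_hist_le_of_adaptivelyDP {e D : ℝ} (hH : AdaptivelyDP H N e D)
    (hg : ∀ i, Measurable (g i)) (hN : 0 < N)
    (hx : ∀ n, n ≠ tstar → x n = x' n) (P : Measure (ℝ × (Fin T → Noise k)))
    (hP : IsProbabilityMeasure P) {S : Set (ℕ → Fin k → ℝ)} (hS : MeasurableSet S) :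
    (H.law.prod P) {q | (run (H.out q.1) g N p x x x q.2.1 q.2.2 T).hist ∈ S} ≤
      ENNReal.ofReal (Real.exp e) *
        (H.law.prod P) {q | (run (H.out q.1) g N p x x x' q.2.1 q.2.2 T).hist ∈ S} +
      ENNReal.ofReal D := by
  set A := simulator (p := p) hg hN hx P hP with hA
  -- The event is reconstructed from coins and answers with stream `x` on both sides, since the view
  -- does not reveal the side; the outputs are the same by `hist_simulate_side`.
  let S' : Set ((ℝ × (Fin T → Noise k)) × (Fin N → Move d) × (Fin N → Fin d → ℝ)) :=
    {v | (simulate g p x N x v.1 v.2.2 T).hist ∈ S}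
  have hS' : MeasurableSet S' :=
    (measurable_hist.comp ((measurable_simulate hg x N T).comp
      (measurable_fst.prodMk measurable_snd.snd))) hS
  have hview : ∀ side, {q : Ω × ℝ × (Fin T → Noise k) | view H A side q.1 q.2 ∈ S'} =
      {q | (run (H.out q.1) g N p x x (sideStream x x' side) q.2.1 q.2.2 T).hist ∈ S} := by
    intro side
    ext q
    have h1 := run_eq_simulate H hg hN hx P hP side q.1 q.2 T (p := p)
    have h2 := hist_simulate_side (g := g) (p := p) hx side q.2 (play H A side q.1 q.2 N).2 T
    rw [← h1] at h2
    change (simulate g p x N x q.2 (play H A side q.1 q.2 N).2 T).hist ∈ S ↔ _ ∈ S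
    rw [← h2]
  have := (hH _ A S' hS').1
  rw [hview, hview] at this
  exact this

end Adversary

/-! ### Privacy of the mechanism -/

section Privacy

variable {d k T N : ℕ} {g : Fin k → (Fin d → ℝ) → ℝ} {p : Setting d k}
  {Ω : Type*} [MeasurableSpace Ω] (H : HistogramMechanism d Ω)

theorem measure_hist_eq (hg : ∀ i, Measurable (g i)) (M : Measure ℝ) (G : Measure (Fin k → ℝ))
    (L : Measure ℝ) [IsProbabilityMeasure M] [IsProbabilityMeasure G] [IsProbabilityMeasure L]
    (x₁ x₂ x₃ : ℕ → Fin d → Bool) {S : Set (ℕ → Fin k → ℝ)} (hS : MeasurableSet S) :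
    (H.law.prod (L.prod (Measure.pi fun _ : Fin T => M.prod (G.prod L))))
        {q | (run (H.out q.1) g N p x₁ x₂ x₃ q.2.1 q.2.2 T).hist ∈ S} =
      ∫⁻ ω, ∫⁻ tau, value (H.out ω) g N p M G L (S.indicator 1) x₁ x₂ x₃ 0 T (init g p tau)
        ∂L ∂H.law := by
  have := H.isProbabilityMeasure_law
  have hm : Measurable fun q : Ω × ℝ × (Fin T → Noise k) =>
      (run (H.out q.1) g N p x₁ x₂ x₃ q.2.1 q.2.2 T).hist :=
    measurable_hist.comp (measurable_run hg (fun l => (H.measurable_out l).comp measurable_fst) N p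
      _ _ _ measurable_snd.fst measurable_snd.snd T)
  have hψ : Measurable (S.indicator (1 : (ℕ → Fin k → ℝ) → ℝ≥0∞)) := measurable_one.indicator hS
  refine (lintegral_indicator_one (hm hS)).symm.trans ?_
  refine (lintegral_prod _ (hψ.comp hm).aemeasurable).trans (lintegral_congr fun ω => ?_)
  refine (lintegral_prod _ ((hψ.comp hm).comp measurable_prodMk_left).aemeasurable).trans
    (lintegral_congr fun tau => ?_)
  exact lintegral_run (T := T) (o := H.out ω) (Δ := N) (p := p) (M := M) (G := G) (L := L) hg hψ x₁ x₂ x₃ tau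

theorem isProbabilityMeasure_coinLaw {ε : ℝ} (hε : 0 < ε) (δ : ℝ) :
    IsProbabilityMeasure (coinLaw k T H ε δ) := by
  have := H.isProbabilityMeasure_law
  have := isProbabilityMeasure_laplace (b := 6 / ε) (by positivity)
  have := isProbabilityMeasure_laplace (b := 12 / ε) (by positivity)
  unfold coinLaw
  infer_instance

/-- The variance is calibrated so that the Gaussian tail with `e = ε / 3` has `e² v / (2k)` equal to
`ln (4 e^{2ε/3} / δ)`. -/
theorem exp_updateVariance {ε δ : ℝ} (hε : 0 < ε) (hδ : 0 < δ) (hδ1 : δ < 1) (hk : 0 < k) :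
    (updateVariance k ε δ).toNNReal ≠ 0 ∧
      Real.exp (ε / 3 / 2 - (ε / 3) ^ 2 * (updateVariance k ε δ).toNNReal / (2 * k)) =
        Real.exp (ε / 6) * (δ / (4 * Real.exp (2 * ε / 3))) := by
  have hk' : (0 : ℝ) < k := by exact_mod_cast hk
  have h1 : 1 < 4 * Real.exp (2 * ε / 3) / δ := by
    rw [one_lt_div hδ]
    have := Real.one_le_exp (x := 2 * ε / 3) (by positivity)
    linarith
  have hv : 0 < updateVariance k ε δ := by
    have := Real.log_pos h1
    unfold updateVariance
    positivity
  refine ⟨by simpa using hv, ?_⟩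
  rw [Real.coe_toNNReal _ hv.le]
  have h2 : (ε / 3) ^ 2 * updateVariance k ε δ / (2 * k) =
      Real.log (4 * Real.exp (2 * ε / 3) / δ) := by
    unfold updateVariance
    field_simp
    ring
  rw [h2, sub_eq_add_neg, Real.exp_add, ← Real.log_inv, Real.exp_log (by positivity), inv_div]
  congr 2
  ring

theorem measure_hist_le {ε δ : ℝ} (hε : 0 < ε) (hδ : 0 < δ) (hδ1 : δ < 1) (hk : 0 < k) (hN : 0 < N)
    (hg : ∀ i, Measurable (g i))
    (hsens : ∀ i (v w : Fin d → ℝ), (∀ j, |v j - w j| ≤ 1) → |g i v - g i w| ≤ 1)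
    (hH : AdaptivelyDP H N (ε / 3) (δ / (2 * Real.exp (2 * ε / 3))))
    {x y : ℕ → Fin d → Bool} {tstar : ℕ} (hxy : ∀ n, n ≠ tstar → x n = y n)
    {S : Set (ℕ → Fin k → ℝ)} (hS : MeasurableSet S) :
    coinLaw k T H ε δ {q | (run (H.out q.1) g N p x x x q.2.1 q.2.2 T).hist ∈ S} ≤
      ENNReal.ofReal (Real.exp ε) *
        coinLaw k T H ε δ {q | (run (H.out q.1) g N p y y y q.2.1 q.2.2 T).hist ∈ S} +
      ENNReal.ofReal δ := by
  have := H.isProbabilityMeasure_law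
  have := isProbabilityMeasure_laplace (b := 6 / ε) (by positivity)
  have := isProbabilityMeasure_laplace (b := 12 / ε) (by positivity)
  obtain ⟨hv, hexp⟩ := exp_updateVariance hε hδ hδ1 hk
  have hψ : Measurable (S.indicator (1 : (ℕ → Fin k → ℝ) → ℝ≥0∞)) := measurable_one.indicator hS
  have hψ1 : ∀ h, S.indicator (1 : (ℕ → Fin k → ℝ) → ℝ≥0∞) h ≤ 1 :=
    fun h => Set.indicator_apply_le' (fun _ => le_rfl) fun _ => zero_le
  set E := ENNReal.ofReal (Real.exp (ε / 3)) with hE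
  set F := ENNReal.ofReal (Real.exp (ε / 6)) with hF
  have hE1 : 1 ≤ E := by
    rw [hE, ENNReal.one_le_ofReal]; exact Real.one_le_exp (by positivity)
  have hF1 : 1 ≤ F := by
    rw [hF, ENNReal.one_le_ofReal]; exact Real.one_le_exp (by positivity)
  have hFF : F * F = E := by
    rw [hF, hE, ← ENNReal.ofReal_mul (by positivity), ← Real.exp_add]
    congr 2
    ring
  have hEEE : E * (E * E) = ENNReal.ofReal (Real.exp ε) := by
    rw [hE, ← ENNReal.ofReal_mul (by positivity), ← ENNReal.ofReal_mul (by positivity),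
      ← Real.exp_add, ← Real.exp_add]
    congr 2
    ring
  set D := ENNReal.ofReal (Real.exp (ε / 6) * (δ / (4 * Real.exp (2 * ε / 3)))) with hD
  set D' := ENNReal.ofReal (δ / (2 * Real.exp (2 * ε / 3))) with hD'
  have hDD : E * D + D' ≤ ENNReal.ofReal δ := by
    rw [hE, hD, hD', ← ENNReal.ofReal_mul (by positivity),
      ← ENNReal.ofReal_add (by positivity) (by positivity)]
    refine ENNReal.ofReal_le_ofReal ?_
    -- The Gaussian error is multiplied by the factor of the `H` exchange and carries its own
    -- `e^{ε/6}`; the product `e^{ε/2}` is absorbed by the `e^{2ε/3}` in the variance.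
    have h1 : Real.exp (ε / 3) * Real.exp (ε / 6) ≤ Real.exp (2 * ε / 3) := by
      rw [← Real.exp_add]; exact Real.exp_le_exp.2 (by linarith)
    have h2 := Real.one_le_exp (x := 2 * ε / 3) (by positivity)
    calc _ = (Real.exp (ε / 3) * Real.exp (ε / 6)) * (δ / (4 * Real.exp (2 * ε / 3))) +
          δ / (2 * Real.exp (2 * ε / 3)) := by ring
      _ ≤ Real.exp (2 * ε / 3) * (δ / (4 * Real.exp (2 * ε / 3))) + δ / (2 * 1) := by gcongr
      _ = 3 / 4 * δ := by field_simp; norm_num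
      _ ≤ δ := by linarith
  set P : (ℕ → Fin d → Bool) → (ℕ → Fin d → Bool) → (ℕ → Fin d → Bool) → ℝ≥0∞ := fun x₁ x₂ x₃ =>
    coinLaw k T H ε δ {q | (run (H.out q.1) g N p x₁ x₂ x₃ q.2.1 q.2.2 T).hist ∈ S} with hP
  have hPv : ∀ x₁ x₂ x₃, P x₁ x₂ x₃ = _ := fun x₁ x₂ x₃ =>
    measure_hist_eq H hg (laplace (12 / ε))
      (Measure.pi fun _ => gaussianReal 0 (updateVariance k ε δ).toNNReal) (laplace (6 / ε))
      x₁ x₂ x₃ hS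
  have hhist : P x x x ≤ E * P x x y + D' :=
    measure_hist_le_of_adaptivelyDP H hH hg hN hxy _ inferInstance hS
  have hgauss : P x x y ≤ E * P x y y + D := by
    rw [hPv, hPv]
    refine lintegral_le_mul_add ENNReal.ofReal_ne_top fun ω =>
      lintegral_le_mul_add ENNReal.ofReal_ne_top fun tau => ?_
    refine value_le_of_update_stream hg hsens hψ hψ1 hE1 ENNReal.ofReal_ne_top ?_ hxy T 0
      (init g p tau) p.s₀ (fun _ => rfl) (fun i => by simp [init])
    intro a b hab f hf hf1
    rw [hD, ← hexp]
    exact gaussian_pi_shift_le hv (by positivity) hab hf hf1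
  have hlaplace : P x y y ≤ E * P y y y := by
    rw [hPv, hPv, ← lintegral_const_mul' _ _ ENNReal.ofReal_ne_top]
    refine lintegral_mono fun ω => ?_
    have h := setLIntegral_value_le (o := H.out ω) (Δ := N) (p := p) (x₂ := y) (x₃ := y)
      (M := laplace (12 / ε)) (L := laplace (6 / ε))
      (G := Measure.pi fun _ => gaussianReal 0 (updateVariance k ε δ).toNNReal)
      hg hsens hψ hF1 ENNReal.ofReal_ne_top ?_ ?_ hxy T 0 (Nat.zero_le _) (init g p 0) Set.univ
      MeasurableSet.univ isUpperSet_univ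
    · rw [Measure.restrict_univ, hFF] at h
      exact h
    -- Shifts by `2` at scale `12/ε` and by `1` at scale `6/ε` each cost `e^{ε/6}`.
    · intro A B hB hAB
      have := laplace_le_of_add_mem (b := 12 / ε) (by positivity) 2 hB hAB
      rwa [show |(2 : ℝ)| / (12 / ε) = ε / 6 by rw [abs_two]; field_simp; norm_num] at this
    · intro f hf
      have := lintegral_laplace_add_le (b := 6 / ε) (by positivity) 1 hf
      rwa [show |(1 : ℝ)| / (6 / ε) = ε / 6 by rw [abs_one]; field_simp] at this
  calc P x x x ≤ E * (E * (E * P y y y) + D) + D' :=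
        hhist.trans (by gcongr; exact hgauss.trans (by gcongr))
    _ = ENNReal.ofReal (Real.exp ε) * P y y y + (E * D + D') := by rw [← hEEE]; ring
    _ ≤ _ := by gcongr

theorem exists_extend_eq {x y : Stream d T} (h : Neighboring x y) :
    ∃ tstar : ℕ, ∀ n, n ≠ tstar → extend x n = extend y n := by
  by_cases hxy : ∃ t, x t ≠ y t
  · obtain ⟨t, ht⟩ := hxy
    refine ⟨t, fun n hn => ?_⟩
    unfold extend
    split_ifs with hnT
    · by_contra hne
      exact hn (congrArg Fin.val (h hne ht))
    · rfl
  · push Not at hxy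
    exact ⟨0, fun n _ => by rw [funext hxy]⟩

theorem kQueryMechanism_zero (x : Stream d T) (r : Coins k T Ω) :
    kQueryMechanism H g 0 p x r = fun _ i => g i 0 := by
  have h : ∀ n, (stateAfter H g 0 p x r n).j = 1 ∧
      (stateAfter H g 0 p x r n).out = fun i => g i 0 := by
    intro n
    induction n with
    | zero => exact ⟨rfl, rfl⟩
    | succ n ih =>
      rw [stateAfter]
      split_ifs
      · unfold step
        dsimp only
        rw [if_neg (by rw [ih.1]; omega)]
        exact ih
      · exact ih
  exact funext fun t => (h _).2

theorem isDP_kQueryMechanism {cmax : ℕ} {ε δ : ℝ} (hε : 0 < ε) (hδ : 0 < δ)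
    (hg : ∀ i, IsMonotoneHistogramQuery (g i)) (hg_meas : ∀ i, Measurable (g i))
    (hH : AdaptivelyDP H (k * cmax) (ε / 3) (δ / (2 * Real.exp (2 * ε / 3))))
    (p : Setting d k) :
    IsDP (T := T) ε δ (coinLaw k T H ε δ) (kQueryMechanism H g (k * cmax) p) := by
  intro x y hxy S hS
  have := isProbabilityMeasure_coinLaw (k := k) (T := T) H hε δ
  rcases le_or_gt 1 δ with hδ1 | hδ1
  · exact prob_le_one.trans ((ENNReal.one_le_ofReal.2 hδ1).trans le_add_self)
  -- With no insertions allowed the output is constant. Otherwise `k` is positive, and the game has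
  -- a round for the challenge.
  rcases Nat.eq_zero_or_pos (k * cmax) with hN | hN
  · simp only [hN, kQueryMechanism_zero]
    refine (le_mul_of_one_le_left zero_le ?_).trans le_self_add
    exact ENNReal.one_le_ofReal.2 (Real.one_le_exp hε.le)
  obtain ⟨tstar, ht⟩ := exists_extend_eq hxy
  have hS' : MeasurableSet {h : ℕ → Fin k → ℝ | (fun t : Fin T => h t) ∈ S} :=
    (measurable_pi_iff.2 fun t : Fin T => measurable_pi_apply (t : ℕ)) hS
  simp only [kQueryMechanism_eq_hist]
  exact measure_hist_le H hε hδ hδ1 (Nat.pos_of_mul_pos_right hN) hN hg_meas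
    (fun i => (hg i).sensitivity) hH ht hS'

end Privacy

end KQuery

theorem mainTheorem6 {d k T cmax : ℕ} {Ω : Type*} [MeasurableSpace Ω]
    (H : KQuery.HistogramMechanism d Ω) {ε δ : ℝ} (hε : 0 < ε) (hδ : 0 < δ)
    (g : Fin k → (Fin d → ℝ) → ℝ)
    (hg : ∀ i, KQuery.IsMonotoneHistogramQuery (g i)) (hg_meas : ∀ i, Measurable (g i))
    (hH : KQuery.AdaptivelyDP H (k * cmax) (ε / 3) (δ / (2 * Real.exp (2 * ε / 3)))) :
    (∀ (β : ℝ) (err : ℕ → ℝ),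
      KQuery.IsDP (T := T) ε δ (KQuery.coinLaw k T H ε δ)
        (KQuery.kQueryMechanism H g (k * cmax)
          (KQuery.standardSetting d k cmax T ε δ β err))) ∧
    (∀ p : KQuery.Setting d k,
      KQuery.IsDP (T := T) ε δ (KQuery.coinLaw k T H ε δ)
        (KQuery.kQueryMechanism H g (k * cmax) p)) :=
  ⟨fun _ _ => KQuery.isDP_kQueryMechanism H hε hδ hg hg_meas hH _,
    fun p => KQuery.isDP_kQueryMechanism H hε hδ hg hg_meas hH p⟩
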